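/- Let $(X,d)$ be a proper, non-compact $\mathrm{CAT}(-1)$ space and let $\Gamma$ be a group acting on $X$ by isometries, properly discontinuously (for every compact $K$, $K\cap\gamma K\neq\emptyset$ for only finitely many $\gamma\in\Gamma$) and cocompactly ($X=\Gamma K$ for some compact $K$). For a metric space $M$ let $C_*(M)$ be the space of continuous real functions on $M$, with the topology of uniform convergence on compact sets, modulo additive constants; let $\iota(p)=[d(p,\cdot)]$, and let the ideal boundary of $M$ be $\partial_\infty M=\overline{\iota(M)}\setminus\iota(M)\subset C_*(M)$. Write $\partial_\infty X$ for the ideal boundary of $(X,d)$ and $\partial_\infty^{\max}(X\times X)$ for that of $X\times X$ with the metric $d_{\max}((x,y),(x',y'))=\max\{d(x,x'),d(y,y')\}$. Fix $o\in X$, and for $\xi\in\partial_\infty X$ let $\beta_\xi^o$ be the representative of $\xi$ with $\beta_\xi^o(o)=0$. Let $D$ be the diagonal of $\partial_\infty X\times\partial_\infty X$ and let $$\Omega=\bigl\{[(z,z')\mapsto\max\{\beta^o_\xi(z),\beta^o_{\xi'}(z')+C\}] : \xi,\xi'\in\partial_\infty X,\ \xi\neq\xi',\ C\in\mathbb R\bigr\}\subset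 C_*(X\times X).$$ Then $\Omega$ is an open subset of $\partial_\infty^{\max}(X\times X)$; the map $(\xi,\xi',C)\mapsto[\max\{\beta^o_\xi,\beta^o_{\xi'}+C\}]$ is a homeomorphism from $((\partial_\infty X\times\partial_\infty X)\setminus D)\times\mathbb R$ onto $\Omega$; and the diagonal action of $\Gamma$ on $X\times X\cup\Omega$ (where $X\times X$ is identified with $\iota(X\times X)$, the topology is that of $C_*(X\times X)$, and $\gamma[h]=[h\circ\gamma^{-1}]$) is properly discontinuous and cocompact. -/

import Mathlib

open Set Topology
open scoped Pointwise UpperHalfPlane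

noncomputable section

/-- `c`, restricted to `[0, dist x y]`, is a geodesic segment joining `x` to `y`, i.e. an isometric
embedding of that interval with the prescribed end points. (Values of `c` elsewhere are
irrelevant.) -/
structure IsGeodesicSegment {X : Type*} [MetricSpace X] (c : ℝ → X) (x y : X) : Prop where
  source : c 0 = x
  target : c (dist x y) = y
  isometric : ∀ s ∈ Icc (0 : ℝ) (dist x y), ∀ t ∈ Icc (0 : ℝ) (dist x y),
    dist (c s) (c t) = |s - t|

/-- `X` is a `CAT(-1)` space: it is a geodesic space, and every geodesic triangle `p q r` has a
comparison triangle `p' q' r'` in the hyperbolic plane such that the distance between two points of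
the triangle is at most the distance between their comparison points.

Any two sides of a triangle issue from a common vertex, so, as `p, q, r` and the sides are
arbitrary, it is enough to treat points `c s`, `e t` on the sides from `p` to `q` and from `p` to
`r`; for two points on one side the inequality is an equality. Comparison triangles always exist
and are unique up to isometry, so it does not matter whether one asks for one or for all. -/
def IsCATMinusOne (X : Type*) [MetricSpace X] : Prop :=
  (∀ x y : X, ∃ c : ℝ → X, IsGeodesicSegment c x y) ∧
  ∀ (p q r : X) (c e : ℝ → X), IsGeodesicSegment c p q → IsGeodesicSegment e p r →
    ∃ (p' q' r' : ℍ) (c' e' : ℝ → ℍ),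
      dist p' q' = dist p q ∧ dist q' r' = dist q r ∧ dist p' r' = dist p r ∧
      IsGeodesicSegment c' p' q' ∧ IsGeodesicSegment e' p' r' ∧
      ∀ s ∈ Icc (0 : ℝ) (dist p q), ∀ t ∈ Icc (0 : ℝ) (dist p r),
        dist (c s) (e t) ≤ dist (c' s) (e' t)

/-- The action of `Γ` on the subset `S` of `T` is properly discontinuous: for every compact
`K ⊆ S`, the set `K ∩ γ K` is nonempty for finitely many `γ` only. -/
def ProperlyDiscontinuousOn (Γ : Type*) {T : Type*} [TopologicalSpace T] [SMul Γ T]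
    (S : Set T) : Prop :=
  ∀ K : Set T, K ⊆ S → IsCompact K → {γ : Γ | (K ∩ γ • K).Nonempty}.Finite

/-- The action of `Γ` on the subset `S` of `T` is cocompact: `S = Γ K` for some compact `K ⊆ S`.
(In particular `S` is invariant when `Γ` is a group acting on `T`.) -/
def CocompactOn (Γ : Type*) {T : Type*} [TopologicalSpace T] [SMul Γ T] (S : Set T) : Prop :=
  ∃ K : Set T, K ⊆ S ∧ IsCompact K ∧ S = ⋃ γ : Γ, γ • K

section Horo

variable (M : Type*) [MetricSpace M]

/-- The constant functions among the continuous real functions on `M`. -/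
def constFns : AddSubgroup C(M, ℝ) where
  carrier := {f | ∃ a : ℝ, f = ContinuousMap.const M a}
  zero_mem' := ⟨0, rfl⟩
  add_mem' := by
    rintro _ _ ⟨a, rfl⟩ ⟨b, rfl⟩
    exact ⟨a + b, rfl⟩
  neg_mem' := by
    rintro _ ⟨a, rfl⟩
    exact ⟨-a, rfl⟩

/-- The space of continuous real functions on `M`, with the topology of uniform convergence on
compact sets, modulo additive constants, with the quotient topology. -/
abbrev FnModConst : Type _ := C(M, ℝ) ⧸ constFns M

variable {M}

/-- The class modulo constants of a continuous function. -/
def fnClass (f : C(M, ℝ)) : FnModConst M := QuotientAddGroup.mk f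

/-- The distance function from a point. -/
def distFn (p : M) : C(M, ℝ) := ⟨fun z => dist p z, by fun_prop⟩

/-- The map sending a point to the class of the distance function from it. -/
def horoEmb (p : M) : FnModConst M := fnClass (distFn p)

variable (M) in
/-- The ideal (horofunction) boundary of `M`: the closure of the image of `M` in the space of
functions modulo constants, minus that image. -/
def horoBoundary : Set (FnModConst M) := closure (range (horoEmb (M := M))) \ range horoEmb

/-- The representative vanishing at the base point `o` of a class of functions modulo constants.
For a boundary point `ξ` of a `CAT(-1)` space it is the Busemann function of `ξ` normalised
at `o`. -/
def normalizedRep (o : M) : FnModConst M →+ C(M, ℝ) :=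
  QuotientAddGroup.lift (constFns M)
    { toFun := fun f => f - ContinuousMap.const M (f o)
      map_zero' := by ext; simp
      map_add' := by intro f g; ext; simp; ring }
    (by rintro _ ⟨a, rfl⟩; ext; simp)

variable {Γ : Type*} [Group Γ] [MulAction Γ M] [IsIsometricSMul Γ M]

/-- The function `z ↦ f (γ⁻¹ z)`, as an additive map in `f`. -/
def translateFn (γ : Γ) : C(M, ℝ) →+ C(M, ℝ) where
  toFun f := f.comp ⟨fun z => γ⁻¹ • z, continuous_const_smul _⟩
  map_zero' := rfl
  map_add' _ _ := rfl

/-- The action of a group of isometries of `M` on functions modulo constants,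
`γ [f] = [f ∘ γ⁻¹]`. -/
instance fnModConstAction : MulAction Γ (FnModConst M) where
  smul γ := QuotientAddGroup.map (constFns M) (constFns M) (translateFn γ)
    (by rintro _ ⟨a, rfl⟩; exact ⟨a, rfl⟩)
  one_smul x := by
    induction x using QuotientAddGroup.induction_on with
    | H f =>
      change fnClass (translateFn (1 : Γ) f) = fnClass f
      congr 1; ext z; simp [translateFn]
  mul_smul γ δ x := by
    induction x using QuotientAddGroup.induction_on with
    | H f =>
      change fnClass (translateFn (γ * δ) f) = fnClass (translateFn γ (translateFn δ f))
      congr 1; ext z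
      change f ((γ * δ)⁻¹ • z) = f (δ⁻¹ • γ⁻¹ • z)
      rw [mul_inv_rev, mul_smul]

/-- The action on functions modulo constants extends the action on `M`. -/
theorem smul_horoEmb (γ : Γ) (p : M) : γ • horoEmb p = horoEmb (γ • p) := by
  change fnClass (translateFn γ (distFn p)) = fnClass (distFn (γ • p))
  congr 1; ext z
  change dist p (γ⁻¹ • z) = dist (γ • p) z
  rw [← dist_smul γ p, smul_inv_smul]

end Horo

section Omega

variable {X : Type*} [MetricSpace X]

/-- The class modulo constants of the function
`(z, z') ↦ max {β_ξ (z), β_ξ' (z') + C}` on `X × X`, where `β_ξ` and `β_ξ'` are normalised at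
`o`. -/
def maxClass (o : X) (ξ ξ' : FnModConst X) (C : ℝ) : FnModConst (X × X) :=
  fnClass ((normalizedRep o ξ).comp ContinuousMap.fst ⊔
    ((normalizedRep o ξ').comp ContinuousMap.snd + ContinuousMap.const (X × X) C))

/-- The parametrization `(ξ, ξ', C) ↦ [max {β_ξ, β_ξ' + C}]` of the ideal domain, with parameters
`(ξ, ξ', C)` in `((∂X × ∂X) ∖ D) × ℝ`. The product `X × X` carries the maximum metric. -/
def idealDomainParam (o : X)
    (q : {q : horoBoundary X × horoBoundary X // q.1 ≠ q.2} × ℝ) : FnModConst (X × X) :=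
  maxClass o q.1.1.1 q.1.1.2 q.2

/-- The ideal domain `Ω`: the part of the boundary which corresponds to
`((∂X × ∂X) ∖ D) × ℝ`. -/
def idealDomain (o : X) : Set (FnModConst (X × X)) := range (idealDomainParam o)

end Omega

end

/-! Everything is read off from the restriction of a class `f` to the diagonal, `z ↦ f (z, z)`.
Among the classes in the compactification of `X × X`, those in `X × X ∪ Ω` are exactly those whose
restriction has a minimum.

For the max metric, the normalised distance function of `(x, y)` is a maximum of two normalised
distance functions with shift `C = d(y, o) - d(x, o)`. When the points escape, a limit is therefore
`max {β_ξ, β_ξ' + C}`, or a single Busemann function if the shift diverges. A single Busemann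
function, which is also the diagonal value when `ξ = ξ'`, is unbounded below and has no minimum
(`mem_union_idealDomain_of_isDiagMin`). Conversely, negative curvature makes `max {β_ξ, β_ξ'}`
coercive when `ξ ≠ ξ'` (`exists_le_max_normalizedRep`): the Gromov product along rays to `ξ` and
`ξ'` stays bounded, since otherwise the Busemann functions would agree.

Minima are controlled by quasi-convexity: if `f (z, z)` exceeds `f (o, o)` on a sphere around `o`,
it does so everywhere outside (`pos_of_mem_diagBarrier`). This condition is open, so minima persist
and stay bounded under small perturbation, whence `Ω` is open in the boundary. Minima are also
equivariant, so the correspondence between `f` and its minimum points transfers proper discontinuity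
and cocompactness from `X`. The parametrization is an embedding because compactness supplies limits
of the parameters and a divergent shift would destroy the minimum. -/

noncomputable section

/-! ### Stewart's theorem in the hyperbolic plane -/

section Hyperbolic

open Real

/-- Linear dependence of three collinear points of the hyperboloid model, tested against a
fourth vector. -/
theorem hyperboloid_stewart {ap bp cp am bm cm aq bq cq aw bw cw s t : ℝ} (ham : 0 < am)
    (hp : ap * cp - bp ^ 2 = 1) (hm : am * cm - bm ^ 2 = 1) (hq : aq * cq - bq ^ 2 = 1)
    (hpm : ap * cm + cp * am - 2 * bp * bm = 2 * cosh s)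
    (hmq : am * cq + cm * aq - 2 * bm * bq = 2 * cosh t)
    (hpq : ap * cq + cp * aq - 2 * bp * bq = 2 * cosh (s + t)) :
    sinh (s + t) * (aw * cm + cw * am - 2 * bw * bm) =
      sinh t * (aw * cp + cw * ap - 2 * bw * bp) + sinh s * (aw * cq + cw * aq - 2 * bw * bq) := by
  -- The vector `v` is the defect in the expected linear relation between `p`, `m`, `q`. It is null
  -- and orthogonal to `m` for the form `ac - b²` of signature (1, 2). Since `m` is timelike, its
  -- orthogonal complement is definite, so `v = 0`.
  obtain ⟨va, hva⟩ : ∃ v, v = sinh (s + t) * am - sinh t * ap - sinh s * aq := ⟨_, rfl⟩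
  obtain ⟨vb, hvb⟩ : ∃ v, v = sinh (s + t) * bm - sinh t * bp - sinh s * bq := ⟨_, rfl⟩
  obtain ⟨vc, hvc⟩ : ∃ v, v = sinh (s + t) * cm - sinh t * cp - sinh s * cq := ⟨_, rfl⟩
  have hs2 := cosh_sq s
  have ht2 := cosh_sq t
  have horth : va * cm + vc * am - 2 * vb * bm = 0 := by
    have : va * cm + vc * am - 2 * vb * bm =
        2 * sinh (s + t) - sinh t * (2 * cosh s) - sinh s * (2 * cosh t) := by
      rw [← hpm, ← hmq, hva, hvb, hvc]
      linear_combination (2 * sinh (s + t)) * hm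
    rw [this, sinh_add]; ring
  have hnull : va * vc - vb ^ 2 = 0 := by
    have : va * vc - vb ^ 2 = sinh (s + t) ^ 2 + sinh t ^ 2 + sinh s ^ 2
        - sinh (s + t) * sinh t * (2 * cosh s) - sinh (s + t) * sinh s * (2 * cosh t)
        + sinh s * sinh t * (2 * cosh (s + t)) := by
      rw [← hpm, ← hmq, ← hpq, hva, hvb, hvc]
      linear_combination (sinh (s + t) ^ 2) * hm + sinh t ^ 2 * hp + sinh s ^ 2 * hq
    rw [this, sinh_add, cosh_add]
    linear_combination (-sinh t ^ 2) * hs2 - sinh s ^ 2 * ht2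
  have hva0 : va = 0 := by
    have h : va ^ 2 + (va * bm - vb * am) ^ 2 = 0 := by
      linear_combination (va * am) * horth - am ^ 2 * hnull - va ^ 2 * hm
    nlinarith [sq_nonneg va, sq_nonneg (va * bm - vb * am)]
  have hvb0 : vb = 0 := by
    rw [hva0] at hnull; nlinarith
  have hvc0 : vc = 0 := by
    rw [hva0, hvb0] at horth
    have : vc * am = 0 := by linarith
    exact (mul_eq_zero.1 this).resolve_right ham.ne'
  rw [hva0] at hva; rw [hvb0] at hvb; rw [hvc0] at hvc
  linear_combination (-aw) * hvc - cw * hva + 2 * bw * hvb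

/-- The point `x + iy` corresponds to the symmetric matrix with entries `1/y`, `x/y`, `(x² + y²)/y`,
of determinant one; the right-hand side is the polarised determinant. -/
theorem UpperHalfPlane.two_mul_cosh_dist (z w : ℍ) : 2 * cosh (dist z w) =
    1 / z.im * ((w.re ^ 2 + w.im ^ 2) / w.im) + (z.re ^ 2 + z.im ^ 2) / z.im * (1 / w.im)
      - 2 * (z.re / z.im) * (w.re / w.im) := by
  have hz := z.im_pos.ne'
  have hw := w.im_pos.ne'
  rw [UpperHalfPlane.cosh_dist']
  field_simp
  ring

/-- **Stewart's theorem** in the hyperbolic plane. -/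
theorem UpperHalfPlane.stewart (p m q w : ℍ) (h : dist p m + dist m q = dist p q) :
    sinh (dist p q) * cosh (dist w m) =
      sinh (dist m q) * cosh (dist w p) + sinh (dist p m) * cosh (dist w q) := by
  have key : ∀ z : ℍ, 1 / z.im * ((z.re ^ 2 + z.im ^ 2) / z.im) - (z.re / z.im) ^ 2 = 1 := by
    intro z
    have hz := z.im_pos.ne'
    field_simp
    ring
  have := hyperboloid_stewart (s := dist p m) (t := dist m q) (aw := 1 / w.im)
    (bw := w.re / w.im) (cw := (w.re ^ 2 + w.im ^ 2) / w.im)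
    (one_div_pos.2 m.im_pos) (key p) (key m) (key q)
    (two_mul_cosh_dist p m).symm (two_mul_cosh_dist m q).symm
    (by rw [h]; exact (two_mul_cosh_dist p q).symm)
  rw [← two_mul_cosh_dist w m, ← two_mul_cosh_dist w p, ← two_mul_cosh_dist w q, h] at this
  linarith

theorem IsGeodesicSegment.dist_source {X : Type*} [MetricSpace X] {c : ℝ → X} {x y : X}
    (hc : IsGeodesicSegment c x y) {s : ℝ} (hs : s ∈ Icc 0 (dist x y)) : dist x (c s) = s := by
  have := hc.isometric 0 ⟨le_rfl, dist_nonneg⟩ s hs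
  rw [hc.source] at this
  rw [this, zero_sub, abs_neg, abs_of_nonneg hs.1]

theorem IsGeodesicSegment.dist_target {X : Type*} [MetricSpace X] {c : ℝ → X} {x y : X}
    (hc : IsGeodesicSegment c x y) {s : ℝ} (hs : s ∈ Icc 0 (dist x y)) :
    dist (c s) y = dist x y - s := by
  have := hc.isometric s hs (dist x y) ⟨dist_nonneg, le_rfl⟩
  rw [hc.target] at this
  rw [this, abs_sub_comm, abs_of_nonneg (by linarith [hs.2])]

theorem UpperHalfPlane.stewart_segment {p q : ℍ} {c : ℝ → ℍ} (hc : IsGeodesicSegment c p q)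
    (w : ℍ) {s : ℝ} (hs : s ∈ Icc 0 (dist p q)) :
    sinh (dist p q) * cosh (dist w (c s)) =
      sinh (dist p q - s) * cosh (dist w p) + sinh s * cosh (dist w q) := by
  have h := UpperHalfPlane.stewart p (c s) q w
    (by rw [hc.dist_source hs, hc.dist_target hs]; ring)
  rwa [hc.dist_source hs, hc.dist_target hs] at h

end Hyperbolic

/-! ### Comparison inequalities in `CAT(-1)` spaces -/

section Comparison

open Real

variable {X : Type*} [MetricSpace X]

/-- Stewart's theorem is an inequality in a `CAT(-1)` space. -/
theorem IsCATMinusOne.stewart_le (hX : IsCATMinusOne X) {p q : X} {c : ℝ → X}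
    (hc : IsGeodesicSegment c p q) (w : X) {s : ℝ} (hs : s ∈ Icc 0 (dist p q)) :
    sinh (dist p q) * cosh (dist w (c s)) ≤
      sinh (dist p q - s) * cosh (dist w p) + sinh s * cosh (dist w q) := by
  obtain ⟨e, he⟩ := hX.1 p w
  obtain ⟨p', q', w', c', e', hpq, hqw, hpw, hc', he', hle⟩ := hX.2 p q w c e hc he
  have h := hle s hs (dist p w) ⟨dist_nonneg, le_rfl⟩
  rw [he.target, ← hpw, he'.target] at h
  have h2 := UpperHalfPlane.stewart_segment hc' w' (s := s) (by rwa [hpq])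
  rw [hpq, dist_comm w' p', dist_comm w' q', hpw, hqw, dist_comm w' (c' s)] at h2
  rw [dist_comm w p, dist_comm w q, ← h2, dist_comm w (c s)]
  have h3 : cosh (dist (c s) w) ≤ cosh (dist (c' s) w') := by
    rw [cosh_le_cosh, abs_of_nonneg dist_nonneg, abs_of_nonneg dist_nonneg]; exact h
  exact mul_le_mul_of_nonneg_left h3 (sinh_nonneg_iff.2 dist_nonneg)

/-- The hyperbolic law of cosines, as a comparison inequality for points on two sides of a
triangle. -/
theorem IsCATMinusOne.cosh_dist_le (hX : IsCATMinusOne X) {p q r : X} {c e : ℝ → X}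
    (hc : IsGeodesicSegment c p q) (he : IsGeodesicSegment e p r) {s t : ℝ}
    (hs : s ∈ Icc 0 (dist p q)) (ht : t ∈ Icc 0 (dist p r)) :
    sinh (dist p q) * sinh (dist p r) * cosh (dist (c s) (e t)) ≤
      sinh (dist p q) * sinh (dist p r) * cosh (s - t) +
        sinh s * sinh t * (cosh (dist q r) - cosh (dist p q - dist p r)) := by
  obtain ⟨p', q', r', c', e', hpq, hqr, hpr, hc', he', hle⟩ := hX.2 p q r c e hc he
  have h := hle s hs t ht
  have hs' : s ∈ Icc 0 (dist p' q') := by rwa [hpq]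
  have ht' : t ∈ Icc 0 (dist p' r') := by rwa [hpr]
  -- Stewart is used twice, from `e' t` to the side `p' q'` and from `q'` to the side `p' r'`;
  -- eliminating `cosh (dist q' (e' t))` gives the law of cosines.
  have h1 := UpperHalfPlane.stewart_segment hc' (e' t) hs'
  have h2 := UpperHalfPlane.stewart_segment he' q' ht'
  rw [dist_comm (e' t) p', he'.dist_source ht', hpq, dist_comm (e' t) (c' s),
    dist_comm (e' t) q'] at h1
  rw [dist_comm q' p', hpq, hpr, hqr] at h2
  have h3 : cosh (dist (c s) (e t)) ≤ cosh (dist (c' s) (e' t)) := by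
    rw [cosh_le_cosh, abs_of_nonneg dist_nonneg, abs_of_nonneg dist_nonneg]; exact h
  have h4 : sinh (dist p q) * sinh (dist p r) * cosh (dist (c s) (e t)) ≤
      sinh (dist p q) * sinh (dist p r) * cosh (dist (c' s) (e' t)) :=
    mul_le_mul_of_nonneg_left h3
      (mul_nonneg (sinh_nonneg_iff.2 dist_nonneg) (sinh_nonneg_iff.2 dist_nonneg))
  refine h4.trans (le_of_eq ?_)
  rw [sinh_sub] at h1 h2
  rw [cosh_sub, cosh_sub]
  linear_combination (sinh (dist p r)) * h1 + sinh s * h2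

/-- The Gromov product. -/
def gromovProduct (o x y : X) : ℝ := (dist o x + dist o y - dist x y) / 2

theorem gromovProduct_comm (o x y : X) : gromovProduct o x y = gromovProduct o y x := by
  simp only [gromovProduct, dist_comm x y]; ring

theorem gromovProduct_le_left (o x y : X) : gromovProduct o x y ≤ dist o x := by
  have := dist_triangle o x y
  simp only [gromovProduct]; linarith

theorem gromovProduct_le_right (o x y : X) : gromovProduct o x y ≤ dist o y := by
  rw [gromovProduct_comm]; exact gromovProduct_le_left o y x

theorem sinh_sub_le_exp_neg_mul {a T : ℝ} (hT : 0 ≤ T) : sinh (a - T) ≤ exp (-T) * sinh a := by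
  have h1 : exp (a - T) = exp (-T) * exp a := by rw [← exp_add]; ring_nf
  have h2 : exp (-(a - T)) = exp T * exp (-a) := by rw [← exp_add]; ring_nf
  have h3 : exp (-T) ≤ exp T := exp_le_exp.2 (by linarith)
  rw [sinh_eq, sinh_eq, h1, h2]
  nlinarith [exp_pos (-a)]

/-- Two sides of a triangle with a large Gromov product stay exponentially close. -/
theorem IsCATMinusOne.dist_le_exp (hX : IsCATMinusOne X) {o x y : X} {c e : ℝ → X}
    (hc : IsGeodesicSegment c o x) (he : IsGeodesicSegment e o y) {s T : ℝ}
    (hs : 0 ≤ s) (hsT : s ≤ T) (hT : T ≤ gromovProduct o x y) :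
    dist (c s) (e s) ≤ exp (s - T) := by
  rcases hs.eq_or_lt with rfl | hs0
  · rw [hc.source, he.source, dist_self]; exact (exp_pos _).le
  have hax := gromovProduct_le_left o x y
  have hay := gromovProduct_le_right o x y
  have hG := le_trans hsT hT
  have hG0 := hs.trans hG
  have h := hX.cosh_dist_le hc he (s := s) (t := s) ⟨hs, hG.trans hax⟩ ⟨hs, hG.trans hay⟩
  set a := dist o x
  set b := dist o y
  set G := gromovProduct o x y with hGdef
  have hd : dist x y = (a - G) + (b - G) := by simp only [hGdef, gromovProduct, a, b]; ring
  have hk : cosh (dist x y) - cosh (a - b) = 2 * (sinh (a - G) * sinh (b - G)) := by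
    rw [hd, show a - b = (a - G) - (b - G) by ring, cosh_add (a - G),
      cosh_sub (a - G)]; ring
  have ha : 0 < sinh a := sinh_pos_iff.2 (by linarith)
  have hb : 0 < sinh b := sinh_pos_iff.2 (by linarith)
  have h1 : sinh (a - G) * sinh (b - G) ≤ (exp (-G) * sinh a) * (exp (-G) * sinh b) :=
    mul_le_mul (sinh_sub_le_exp_neg_mul hG0) (sinh_sub_le_exp_neg_mul hG0)
      (sinh_nonneg_iff.2 (by linarith)) (by positivity)
  rw [hk, sub_self, cosh_zero] at h
  have hss : 0 < sinh s := sinh_pos_iff.2 hs0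
  have h2 : cosh (dist (c s) (e s)) ≤ 1 + 2 * (sinh s * exp (-G)) ^ 2 := by
    have h3 : sinh s * sinh s * (2 * (sinh (a - G) * sinh (b - G))) ≤
        sinh s * sinh s * (2 * ((exp (-G) * sinh a) * (exp (-G) * sinh b))) := by gcongr
    have h4 : sinh a * sinh b * cosh (dist (c s) (e s)) ≤
        sinh a * sinh b * (1 + 2 * (sinh s * exp (-G)) ^ 2) := by
      refine (h.trans (add_le_add_right h3 _)).trans (le_of_eq ?_); ring
    exact le_of_mul_le_mul_left h4 (mul_pos ha hb)
  have h5 : sinh s * exp (-G) ≤ exp (s - T) / 2 := by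
    have : sinh s ≤ exp s / 2 := by rw [sinh_eq]; linarith [exp_pos (-s)]
    calc sinh s * exp (-G) ≤ exp s / 2 * exp (-T) := by gcongr
      _ = exp (s - T) / 2 := by rw [sub_eq_add_neg, exp_add]; ring
  -- Half-angle form: the bound on `cosh` becomes one on `sinh` of half the distance, which
  -- dominates half the distance.
  have h6 : 1 + 2 * (sinh (dist (c s) (e s) / 2)) ^ 2 = cosh (dist (c s) (e s)) := by
    conv_rhs => rw [show dist (c s) (e s) = 2 * (dist (c s) (e s) / 2) by ring, cosh_two_mul]
    linear_combination -(cosh_sq (dist (c s) (e s) / 2))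
  have h7 : sinh (dist (c s) (e s) / 2) ≤ sinh s * exp (-G) := by
    refine abs_le_of_sq_le_sq' (by linarith) (by positivity) |>.2
  have h8 : dist (c s) (e s) / 2 ≤ sinh (dist (c s) (e s) / 2) :=
    self_le_sinh_iff.2 (by positivity)
  linarith

/-- Gromov hyperbolicity. -/
theorem IsCATMinusOne.hyperbolic (hX : IsCATMinusOne X) {o x y z : X} {T : ℝ} (hT : 0 ≤ T)
    (hxz : T ≤ gromovProduct o x z) (hzy : T ≤ gromovProduct o z y) :
    T - 1 ≤ gromovProduct o x y := by
  obtain ⟨c, hc⟩ := hX.1 o x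
  obtain ⟨e, he⟩ := hX.1 o y
  obtain ⟨g, hg⟩ := hX.1 o z
  -- At time `T` the geodesics to `x` and `y` are both within 1 of the geodesic to `z`; the
  -- resulting gap 2 costs 1 in the Gromov product.
  have h1 := hX.dist_le_exp hc hg hT le_rfl hxz
  have h2 := hX.dist_le_exp hg he hT le_rfl hzy
  rw [sub_self, exp_zero] at h1 h2
  have h3 := hc.dist_target (s := T) ⟨hT, hxz.trans (gromovProduct_le_left ..)⟩
  have h4 := he.dist_target (s := T) ⟨hT, hzy.trans (gromovProduct_le_right ..)⟩
  have h5 := dist_triangle4 x (c T) (e T) y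
  have h6 := dist_triangle (c T) (g T) (e T)
  rw [dist_comm x (c T)] at h5
  simp only [gromovProduct]
  linarith

/-- Balls are quasi-convex. -/
theorem IsCATMinusOne.dist_le_max (hX : IsCATMinusOne X) {p q : X} {c : ℝ → X}
    (hc : IsGeodesicSegment c p q) (w : X) {s : ℝ} (hs : s ∈ Icc 0 (dist p q)) :
    dist w (c s) ≤ max (dist w p) (dist w q) := by
  rcases (dist_nonneg (x := p) (y := q)).eq_or_lt with h0 | h0
  · have : s = 0 := le_antisymm (h0 ▸ hs.2) hs.1
    rw [this, hc.source]; exact le_max_left _ _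
  have h := hX.stewart_le hc w hs
  have hm : 0 ≤ max (dist w p) (dist w q) := le_max_of_le_left dist_nonneg
  have h1 : ∀ x : ℝ, 0 ≤ x → x ≤ max (dist w p) (dist w q) →
      cosh x ≤ cosh (max (dist w p) (dist w q)) := by
    intro x hx hxm
    rw [cosh_le_cosh, abs_of_nonneg hx, abs_of_nonneg hm]; exact hxm
  set μ := max (dist w p) (dist w q)
  have hp := h1 _ dist_nonneg (le_max_left (dist w p) (dist w q))
  have hq := h1 _ dist_nonneg (le_max_right (dist w p) (dist w q))
  have hs1 : 0 ≤ sinh s := sinh_nonneg_iff.2 hs.1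
  have hs2 : 0 ≤ sinh (dist p q - s) := sinh_nonneg_iff.2 (by linarith [hs.2])
  -- The weights in Stewart's inequality have total at most `sinh (dist p q)`, because `cosh ≥ 1` in
  -- the addition formula.
  have hsum : sinh (dist p q - s) + sinh s ≤ sinh (dist p q) := by
    have : sinh (dist p q) = sinh (dist p q - s) * cosh s + cosh (dist p q - s) * sinh s := by
      rw [← sinh_add]; ring_nf
    rw [this]
    nlinarith [one_le_cosh s, one_le_cosh (dist p q - s)]
  have hL : 0 < sinh (dist p q) := sinh_pos_iff.2 h0
  have h2 : sinh (dist p q) * cosh (dist w (c s)) ≤ sinh (dist p q) * cosh μ := by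
    have hμ : 0 ≤ cosh μ := (cosh_pos _).le
    calc _ ≤ _ := h
      _ ≤ sinh (dist p q - s) * cosh μ + sinh s * cosh μ := by gcongr
      _ = (sinh (dist p q - s) + sinh s) * cosh μ := by ring
      _ ≤ _ := by gcongr
  have h3 := le_of_mul_le_mul_left h2 hL
  rwa [cosh_le_cosh, abs_of_nonneg dist_nonneg, abs_of_nonneg hm] at h3

/-- Moving a point `x` towards `o`, up to distance `s`, changes its normalised distance function
very little on a ball around `o`. -/
theorem IsCATMinusOne.busemann_segment_le (hX : IsCATMinusOne X) {o x : X} {c : ℝ → X}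
    (hc : IsGeodesicSegment c o x) {s R : ℝ} (hs : s ∈ Icc 0 (dist o x)) (hR : 0 ≤ R)
    (hRs : R ≤ s) {z : X} (hz : dist o z ≤ R) :
    dist (c s) z - s ≤ dist x z - dist o x + 3 * exp (R - s) := by
  rcases hs.1.eq_or_lt with h0 | h0
  · rw [← h0, hc.source]
    have h1 := exp_pos (R - 0)
    have h2 := add_one_le_exp (R - 0)
    have h3 := dist_triangle o z x
    have h4 := dist_triangle o x z
    rw [dist_comm z x] at h3
    linarith
  have h := hX.stewart_le hc z hs
  set a := dist o x
  have ha0 : 0 < a := h0.trans_le hs.2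
  have ha : 0 < sinh a := sinh_pos_iff.2 ha0
  have e1 : sinh (a - s) ≤ exp (-s) * sinh a := sinh_sub_le_exp_neg_mul hs.1
  have e2 : sinh s ≤ exp (-(a - s)) * sinh a := by
    have := sinh_sub_le_exp_neg_mul (a := a) (T := a - s) (by linarith [hs.2])
    rwa [sub_sub_cancel] at this
  rw [dist_comm z (c s), dist_comm z o, dist_comm z x] at h
  set D := dist x z
  set D' := dist (c s) z
  set r := dist o z
  have hD : a - R ≤ D := by
    have := dist_triangle o z x
    rw [dist_comm z x] at this
    linarith
  have h1 : cosh D' ≤ exp (-s) * cosh r + exp (-(a - s)) * cosh D := by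
    refine le_of_mul_le_mul_left (h.trans ?_) ha
    calc _ ≤ (exp (-s) * sinh a) * cosh r + (exp (-(a - s)) * sinh a) * cosh D := by
          have := cosh_pos r
          have := cosh_pos D
          gcongr
      _ = _ := by ring
  have hr : cosh r ≤ exp R := by
    have : exp (-r) ≤ exp R := exp_le_exp.2 (by linarith [dist_nonneg (x := o) (y := z)])
    have : exp r ≤ exp R := exp_le_exp.2 hz
    rw [cosh_eq]; linarith
  have hDc : cosh D ≤ (exp D + 1) / 2 := by
    have : exp (-D) ≤ 1 := exp_le_one_iff.2 (by linarith [dist_nonneg (x := x) (y := z)])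
    rw [cosh_eq]; linarith
  have hD'c : exp D' / 2 ≤ cosh D' := by rw [cosh_eq]; linarith [exp_pos (-D')]
  have h2 : exp D' ≤ 2 * exp (R - s) + exp (s - a + D) + exp (s - a) := by
    have i1 : exp (-s) * cosh r ≤ exp (-s) * exp R := by gcongr
    have i2 : exp (-(a - s)) * cosh D ≤ exp (-(a - s)) * ((exp D + 1) / 2) := by gcongr
    have i3 : exp (R - s) = exp (-s) * exp R := by rw [← exp_add]; ring_nf
    have i4 : exp (s - a + D) = exp (-(a - s)) * exp D := by rw [← exp_add]; ring_nf
    have i5 : exp (s - a) = exp (-(a - s)) := by ring_nf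
    rw [i3, i4, i5]
    linarith
  -- The main term `exp (s - a + D)` is divided out. Its exponent is nonnegative since `D ≥ a - R`
  -- and `R ≤ s`, so the error terms remain of order `exp (R - s)`.
  have h3 : exp (D' - (s - a + D)) ≤ 1 + 3 * exp (R - s) := by
    have j0 : exp (D' - (s - a + D)) = exp D' * exp (-(s - a + D)) := by
      rw [← exp_add]; ring_nf
    have j1 : exp (R - s) * exp (-(s - a + D)) ≤ exp (R - s) := by
      have : exp (-(s - a + D)) ≤ 1 := exp_le_one_iff.2 (by linarith)
      nlinarith [exp_pos (R - s)]
    have j2 : exp (s - a) * exp (-(s - a + D)) ≤ exp (R - s) := by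
      rw [← exp_add]; exact exp_le_exp.2 (by linarith [hs.2])
    have j3 : exp (s - a + D) * exp (-(s - a + D)) = 1 := by rw [← exp_add]; simp
    have j4 := mul_le_mul_of_nonneg_right h2 (exp_pos (-(s - a + D))).le
    rw [j0]
    nlinarith
  have h4 := add_one_le_exp (D' - (s - a + D))
  linarith

/-- If the Gromov product of two points is large, then their normalised distance functions
almost agree on a ball. -/
theorem IsCATMinusOne.abs_busemann_sub_le (hX : IsCATMinusOne X) {o x y z : X} {R T : ℝ}
    (hR : 0 ≤ R) (hT : 2 * R ≤ T) (hxy : T ≤ gromovProduct o x y) (hz : dist o z ≤ R) :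
    |(dist x z - dist o x) - (dist y z - dist o y)| ≤ 4 * exp (R - T / 2) := by
  obtain ⟨c, hc⟩ := hX.1 o x
  obtain ⟨e, he⟩ := hX.1 o y
  -- Both points are replaced by points at distance `T / 2` from `o`. This costs `3 * exp (R - T /
  -- 2)`, and the gap between the new points costs at most one more such exponential.
  have hs : 0 ≤ T / 2 := by linarith
  have hx : T / 2 ∈ Icc 0 (dist o x) :=
    ⟨hs, by linarith [gromovProduct_le_left o x y]⟩
  have hy : T / 2 ∈ Icc 0 (dist o y) :=
    ⟨hs, by linarith [gromovProduct_le_right o x y]⟩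
  have h1 := hX.dist_le_exp hc he hs (by linarith) hxy
  have h1' : exp (T / 2 - T) ≤ exp (R - T / 2) := exp_le_exp.2 (by linarith)
  have h2 := hX.busemann_segment_le hc hx hR (by linarith) hz
  have h3 := hX.busemann_segment_le he hy hR (by linarith) hz
  have h4 := dist_triangle x (c (T / 2)) z
  have h5 := dist_triangle y (e (T / 2)) z
  have h6 := hc.dist_target hx
  have h7 := he.dist_target hy
  have h8 := dist_triangle (c (T / 2)) (e (T / 2)) z
  have h9 := dist_triangle (e (T / 2)) (c (T / 2)) z
  rw [dist_comm x (c _)] at h4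
  rw [dist_comm y (e _)] at h5
  rw [dist_comm (e _) (c _)] at h9
  rw [abs_le]
  constructor <;> linarith

end Comparison

/-! ### Functions modulo constants and the horofunction compactification -/

section FunctionSpace

open Filter Metric

variable {M : Type*} [MetricSpace M]

theorem normalizedRep_fnClass (o : M) (f : C(M, ℝ)) (z : M) :
    normalizedRep o (fnClass f) z = f z - f o := rfl

theorem normalizedRep_horoEmb (o p z : M) :
    normalizedRep o (horoEmb p) z = dist p z - dist p o := rfl

theorem fnClass_surjective : Function.Surjective (fnClass (M := M)) :=
  QuotientAddGroup.mk_surjective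

theorem fnClass_normalizedRep (o : M) (ξ : FnModConst M) : fnClass (normalizedRep o ξ) = ξ := by
  obtain ⟨f, rfl⟩ := fnClass_surjective ξ
  refine QuotientAddGroup.eq.2 ⟨f o, ?_⟩
  ext z
  simp [normalizedRep_fnClass]

theorem normalizedRep_self (o : M) (ξ : FnModConst M) : normalizedRep o ξ o = 0 := by
  obtain ⟨f, rfl⟩ := fnClass_surjective ξ
  rw [normalizedRep_fnClass, sub_self]

theorem FnModConst.ext_normalizedRep (o : M) {ξ η : FnModConst M}
    (h : ∀ z, normalizedRep o ξ z = normalizedRep o η z) : ξ = η := by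
  rw [← fnClass_normalizedRep o ξ, ← fnClass_normalizedRep o η]
  congr 1
  ext z
  exact h z

theorem continuous_fnClass : Continuous (fnClass (M := M)) := continuous_quot_mk

theorem continuous_normalizedRep (o : M) : Continuous (normalizedRep o) := by
  refine continuous_quot_lift _ ?_
  change Continuous fun f : C(M, ℝ) => f - ContinuousMap.const M (f o)
  have h : Continuous fun f : C(M, ℝ) => ContinuousMap.const M (f o) :=
    ContinuousMap.continuous_const'.comp (continuous_eval_const o)
  exact continuous_id.sub h

theorem continuous_normalizedRep_apply (o z : M) :
    Continuous fun ξ : FnModConst M => normalizedRep o ξ z :=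
  (continuous_eval_const z).comp (continuous_normalizedRep o)

instance : T2Space (FnModConst M) := by
  by_cases hM : Nonempty M
  · obtain ⟨o⟩ := hM
    exact T2Space.of_injective_continuous
      (fun _ _ h => FnModConst.ext_normalizedRep o fun z => DFunLike.congr_fun h z)
      (continuous_normalizedRep o)
  · rw [not_nonempty_iff] at hM
    have : Subsingleton (FnModConst M) := by
      refine ⟨fun ξ η => ?_⟩
      obtain ⟨f, rfl⟩ := fnClass_surjective ξ
      obtain ⟨g, rfl⟩ := fnClass_surjective η
      congr 1
      ext z
      exact hM.elim z
    infer_instance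

theorem continuous_horoEmb : Continuous (horoEmb (M := M)) := by
  refine continuous_fnClass.comp (ContinuousMap.continuous_of_continuous_uncurry _ ?_)
  exact continuous_dist

variable (M) in
/-- The horofunction compactification. -/
def horoClosure : Set (FnModConst M) := closure (range (horoEmb (M := M)))

theorem isClosed_horoClosure : IsClosed (horoClosure M) := isClosed_closure

theorem horoEmb_mem_horoClosure (p : M) : horoEmb p ∈ horoClosure M :=
  subset_closure ⟨p, rfl⟩

theorem normalizedRep_sub_le_dist {ξ : FnModConst M} (hξ : ξ ∈ horoClosure M) (o z w : M) :
    normalizedRep o ξ z - normalizedRep o ξ w ≤ dist z w := by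
  have hc : IsClosed {ξ : FnModConst M | normalizedRep o ξ z - normalizedRep o ξ w ≤ dist z w} :=
    isClosed_le ((continuous_normalizedRep_apply o z).sub (continuous_normalizedRep_apply o w))
      continuous_const
  refine closure_minimal ?_ hc hξ
  rintro _ ⟨p, rfl⟩
  simp only [mem_ofPred_eq, normalizedRep_horoEmb]
  have := dist_triangle p w z
  rw [dist_comm w z] at this
  linarith

/-- By Arzelà–Ascoli, the 1-Lipschitz functions vanishing at `o` form a compact set, and every
distance function has such a representative. -/
theorem isCompact_horoClosure [ProperSpace M] : IsCompact (horoClosure M) := by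
  rcases isEmpty_or_nonempty M with hM | ⟨⟨o⟩⟩
  · have : horoClosure M = ∅ := by simp [horoClosure, range_eq_empty]
    rw [this]; exact isCompact_empty
  let L : Set C(M, ℝ) := {f | f o = 0 ∧ LipschitzWith 1 f}
  have hL : IsCompact L := by
    refine ArzelaAscoli.isCompact_of_equicontinuous L ?_ ?_
    · have him : ContinuousMap.toFun '' L = {f : M → ℝ | f o = 0 ∧ LipschitzWith 1 f} := by
        ext f
        constructor
        · rintro ⟨g, hg, rfl⟩; exact hg
        · intro hf; exact ⟨⟨f, hf.2.continuous⟩, hf, rfl⟩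
      rw [him]
      refine IsCompact.of_isClosed_subset
        (isCompact_univ_pi fun z => isCompact_closedBall (0 : ℝ) (dist z o)) ?_ ?_
      · have : {f : M → ℝ | f o = 0 ∧ LipschitzWith 1 f} =
            {f : M → ℝ | f o = 0} ∩ ⋂ (x : M) (y : M), {f : M → ℝ | dist (f x) (f y) ≤ dist x y} := by
          ext f
          simp [lipschitzWith_iff_dist_le_mul]
        rw [this]
        refine (isClosed_eq (continuous_apply o) continuous_const).inter
          (isClosed_iInter fun x => isClosed_iInter fun y => ?_)
        exact isClosed_le ((continuous_apply x).dist (continuous_apply y)) continuous_const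
      · rintro f ⟨h0, hf⟩ z -
        have := hf.dist_le_mul z o
        rw [h0] at this
        simpa using this
    · exact (LipschitzWith.uniformEquicontinuous _ 1 fun f => f.2.2).equicontinuous
  refine (hL.image continuous_fnClass).closure_of_subset ?_
  rintro _ ⟨p, rfl⟩
  refine ⟨normalizedRep o (horoEmb p), ⟨normalizedRep_self _ _, ?_⟩, fnClass_normalizedRep _ _⟩
  refine LipschitzWith.of_le_add fun x y => ?_
  linarith [normalizedRep_sub_le_dist (horoEmb_mem_horoClosure p) o x y]

/-- In the horofunction compactification, pointwise convergence is convergence. -/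
theorem tendsto_of_tendsto_normalizedRep [ProperSpace M] (o : M) {α : Type*} {l : Filter α}
    {u : α → FnModConst M} {ξ : FnModConst M} (hu : ∀ a, u a ∈ horoClosure M)
    (h : ∀ z, Tendsto (fun a => normalizedRep o (u a) z) l (𝓝 (normalizedRep o ξ z))) :
    Tendsto u l (𝓝 ξ) := by
  rw [tendsto_iff_ultrafilter]
  intro g hg
  obtain ⟨η, -, hη⟩ := isCompact_horoClosure.ultrafilter_le_nhds (g.map u)
    (by rw [le_principal_iff, Ultrafilter.coe_map, mem_map]; exact univ_mem' hu)
  have hη' : Tendsto u g (𝓝 η) := hη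
  have : η = ξ := FnModConst.ext_normalizedRep o fun z =>
    tendsto_nhds_unique (((continuous_normalizedRep_apply o z).tendsto η).comp hη')
      ((h z).mono_left hg)
  rwa [← this]

/-- Projection along a compact factor is a closed map. This makes both unit-speed descent and having
a diagonal minimum in a compact set closed conditions. -/
theorem IsCompact.isClosed_setOf_exists {F Y : Type*} [TopologicalSpace F] [TopologicalSpace Y]
    {K : Set Y} (hK : IsCompact K) {P : F → Y → Prop} (hP : IsClosed {x : F × Y | P x.1 x.2}) :
    IsClosed {f | ∃ q ∈ K, P f q} := by
  have : CompactSpace K := isCompact_iff_compactSpace.1 hK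
  have h := isClosedMap_fst_of_compactSpace (X := F) (Y := K) _
    (hP.preimage (continuous_fst.prodMk (continuous_subtype_val.comp continuous_snd)))
  convert h using 1
  ext f
  constructor
  · rintro ⟨q, hq, hfq⟩; exact ⟨(f, ⟨q, hq⟩), hfq, rfl⟩
  · rintro ⟨⟨_, q⟩, hfq, rfl⟩; exact ⟨q, q.2, hfq⟩

theorem continuous_normalizedRep_uncurry [ProperSpace M] (o : M) :
    Continuous fun x : FnModConst M × M => normalizedRep o x.1 x.2 :=
  ((continuous_normalizedRep o).comp continuous_fst).eval continuous_snd

/-- The function descends at unit speed up to distance `r` from the point `p`. -/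
def Descends (o : M) (ξ : FnModConst M) (p : M) (r : ℝ) : Prop :=
  ∃ q ∈ closedBall p r, normalizedRep o ξ q ≤ normalizedRep o ξ p - r

theorem isClosed_setOf_descends [ProperSpace M] (o p : M) (r : ℝ) :
    IsClosed {ξ : FnModConst M | Descends o ξ p r} := by
  refine (isCompact_closedBall p r).isClosed_setOf_exists (P := fun ξ q =>
    normalizedRep o ξ q ≤ normalizedRep o ξ p - r) ?_
  exact isClosed_le (continuous_normalizedRep_uncurry o)
    (((continuous_normalizedRep_apply o p).comp continuous_fst).sub continuous_const)

theorem descends_horoEmb (hM : ∀ x y : M, ∃ c : ℝ → M, IsGeodesicSegment c x y) (o : M) {p x : M}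
    {r : ℝ} (hr : 0 ≤ r) (hx : r ≤ dist p x) : Descends o (horoEmb x) p r := by
  obtain ⟨c, hc⟩ := hM p x
  refine ⟨c r, ?_, ?_⟩
  · rw [mem_closedBall, dist_comm, hc.dist_source ⟨hr, hx⟩]
  · rw [normalizedRep_horoEmb, normalizedRep_horoEmb, dist_comm x (c r), hc.dist_target ⟨hr, hx⟩,
      dist_comm p x]
    linarith

/-- A distance function descends at unit speed only as far as its centre. Descent to depth `r` is a
closed condition satisfied by all centres outside a compact ball, so it passes to boundary points; a
centre itself admits no descent. -/
theorem mem_horoBoundary_iff [ProperSpace M]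
    (hM : ∀ x y : M, ∃ c : ℝ → M, IsGeodesicSegment c x y) (o : M) {ξ : FnModConst M} :
    ξ ∈ horoBoundary M ↔ ξ ∈ horoClosure M ∧ ∀ p, ∀ r, 0 ≤ r → Descends o ξ p r := by
  constructor
  · rintro ⟨hcl, hnr⟩
    refine ⟨hcl, fun p r hr => ?_⟩
    have hsub : range (horoEmb (M := M)) ⊆
        horoEmb '' closedBall p r ∪ {ξ : FnModConst M | Descends o ξ p r} := by
      rintro _ ⟨x, rfl⟩
      rcases le_total (dist x p) r with h | h
      · exact Or.inl ⟨x, h, rfl⟩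
      · exact Or.inr (descends_horoEmb hM o hr (by rwa [dist_comm]))
    have := closure_minimal hsub
      (((isCompact_closedBall p r).image continuous_horoEmb).isClosed.union
        (isClosed_setOf_descends o p r)) hcl
    rcases this with ⟨x, -, hx⟩ | h
    · exact absurd ⟨x, hx⟩ hnr
    · exact h
  · rintro ⟨hcl, hd⟩
    refine ⟨hcl, ?_⟩
    rintro ⟨x, rfl⟩
    obtain ⟨q, -, hq⟩ := hd x 1 zero_le_one
    rw [normalizedRep_horoEmb, normalizedRep_horoEmb, dist_self] at hq
    linarith [dist_nonneg (x := x) (y := q)]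

theorem isClosed_horoBoundary [ProperSpace M]
    (hM : ∀ x y : M, ∃ c : ℝ → M, IsGeodesicSegment c x y) : IsClosed (horoBoundary M) := by
  rcases isEmpty_or_nonempty M with hE | ⟨⟨o⟩⟩
  · have : horoBoundary M = ∅ := by simp [horoBoundary, range_eq_empty]
    rw [this]; exact isClosed_empty
  have : horoBoundary M = horoClosure M ∩
      ⋂ (p : M) (r : ℝ) (_ : 0 ≤ r), {ξ | Descends o ξ p r} := by
    ext ξ
    rw [mem_horoBoundary_iff hM o]
    simp
  rw [this]
  exact isClosed_horoClosure.inter (isClosed_iInter fun p => isClosed_iInter fun r =>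
    isClosed_iInter fun _ => isClosed_setOf_descends o p r)

theorem exists_dist_eq_of_descends {o : M} {ξ : FnModConst M} (hcl : ξ ∈ horoClosure M)
    {r : ℝ} (h : Descends o ξ o r) : ∃ x, dist o x = r ∧ normalizedRep o ξ x = -r := by
  obtain ⟨q, hq, hle⟩ := h
  rw [normalizedRep_self, zero_sub] at hle
  have h1 := normalizedRep_sub_le_dist hcl o o q
  rw [normalizedRep_self, zero_sub] at h1
  rw [mem_closedBall, dist_comm] at hq
  exact ⟨q, by linarith, by linarith⟩

end FunctionSpace

/-! ### Busemann functions in `CAT(-1)` spaces -/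

section Busemann

open Filter Metric Real

variable {X : Type*} [MetricSpace X]

/-- Points along a ray towards `ξ` approximate its Busemann function. -/
theorem IsCATMinusOne.abs_sub_normalizedRep_le (hX : IsCATMinusOne X) {o x : X} {t : ℝ}
    {ξ : FnModConst X} (hcl : ξ ∈ horoClosure X) (hox : dist o x = t)
    (hx : normalizedRep o ξ x = -t) {R : ℝ} (hR : 0 ≤ R) (ht : 2 * R ≤ t - 1) {z : X}
    (hz : dist o z ≤ R) :
    |(dist x z - t) - normalizedRep o ξ z| ≤ 4 * exp (R - (t - 1) / 2) := by
  -- For the distance function of `y`, membership in `U` says that the Gromov product of `x` and `y`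
  -- exceeds `t - 1`. The slack makes the condition open, so it holds near `ξ`.
  let U : Set (FnModConst X) := {η | normalizedRep o η x < -t + 2}
  have hU : IsOpen U := isOpen_lt (continuous_normalizedRep_apply o x) continuous_const
  have hξU : ξ ∈ U := by simp only [U, mem_ofPred_eq, hx]; linarith
  have hc : IsClosed {η : FnModConst X |
      |(dist x z - t) - normalizedRep o η z| ≤ 4 * exp (R - (t - 1) / 2)} :=
    isClosed_le (continuous_const.sub (continuous_normalizedRep_apply o z)).abs continuous_const
  refine closure_minimal ?_ hc (hU.inter_closure ⟨hξU, hcl⟩)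
  rintro _ ⟨hyU, y, rfl⟩
  simp only [U, mem_ofPred_eq, normalizedRep_horoEmb] at hyU ⊢
  rw [dist_comm y o] at *
  have h := hX.abs_busemann_sub_le (o := o) (x := x) (y := y) hR ht
    (by simp only [gromovProduct]; rw [dist_comm x y]; linarith) hz
  rwa [hox] at h

/-- A ray from `o` to a boundary point. -/
theorem IsCATMinusOne.exists_ray [ProperSpace X] (hX : IsCATMinusOne X) (o : X)
    {ξ : FnModConst X} (hξ : ξ ∈ horoBoundary X) :
    ∃ x : ℝ → X, (∀ t, 0 ≤ t → dist o (x t) = t) ∧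
      (∀ t, 0 ≤ t → normalizedRep o ξ (x t) = -t) ∧
      ∀ z, Tendsto (fun t => dist (x t) z - t) atTop (𝓝 (normalizedRep o ξ z)) := by
  obtain ⟨hcl, hd⟩ := (mem_horoBoundary_iff hX.1 o).1 hξ
  have h : ∀ t : ℝ, ∃ x, 0 ≤ t → dist o x = t ∧ normalizedRep o ξ x = -t := by
    intro t
    by_cases ht : 0 ≤ t
    · obtain ⟨x, hx⟩ := exists_dist_eq_of_descends hcl (hd o t ht)
      exact ⟨x, fun _ => hx⟩
    · exact ⟨o, fun h => absurd h ht⟩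
  choose x hx using h
  refine ⟨x, fun t ht => (hx t ht).1, fun t ht => (hx t ht).2, fun z => ?_⟩
  rw [tendsto_iff_norm_sub_tendsto_zero]
  refine squeeze_zero' (g := fun t => 4 * exp (dist o z - (t - 1) / 2))
    (Eventually.of_forall fun _ => norm_nonneg _) ?_ ?_
  · filter_upwards [eventually_ge_atTop (2 * dist o z + 1)] with t ht
    have h0 : 0 ≤ t := by linarith [dist_nonneg (x := o) (y := z)]
    exact hX.abs_sub_normalizedRep_le hcl (hx t h0).1 (hx t h0).2 dist_nonneg (by linarith) le_rfl
  · rw [show (0 : ℝ) = 4 * 0 by simp]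
    refine (tendsto_exp_atBot.comp ?_).const_mul 4
    have : Tendsto (fun t : ℝ => t * (-(1 / 2)) + (dist o z + 1 / 2)) atTop atBot :=
      tendsto_atBot_add_const_right _ _ (tendsto_id.atTop_mul_const_of_neg (by norm_num))
    refine this.congr fun t => ?_
    ring

/-- The Busemann functions of two distinct boundary points have a coercive maximum. -/
theorem IsCATMinusOne.exists_le_max_normalizedRep [ProperSpace X] (hX : IsCATMinusOne X) (o : X)
    {ξ η : FnModConst X} (hξ : ξ ∈ horoBoundary X) (hη : η ∈ horoBoundary X) (hne : ξ ≠ η) :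
    ∃ c, ∀ z, dist o z - c ≤ max (normalizedRep o ξ z) (normalizedRep o η z) := by
  obtain ⟨x, hox, -, hx⟩ := hX.exists_ray o hξ
  obtain ⟨y, hoy, -, hy⟩ := hX.exists_ray o hη
  obtain ⟨z, hz⟩ : ∃ z, normalizedRep o ξ z ≠ normalizedRep o η z := by
    by_contra! h
    exact hne (FnModConst.ext_normalizedRep o h)
  have hε : 0 < |normalizedRep o ξ z - normalizedRep o η z| := abs_pos.2 (sub_ne_zero.2 hz)
  -- A Gromov product of at least `T` would bring the two functions closer at `z` than they are in
  -- the limit.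
  obtain ⟨T, hTR, hTε⟩ : ∃ T : ℝ, 2 * dist o z ≤ T ∧
      4 * exp (dist o z - T / 2) < |normalizedRep o ξ z - normalizedRep o η z| := by
    have : Tendsto (fun T : ℝ => 4 * exp (dist o z - T / 2)) atTop (𝓝 (4 * 0)) := by
      refine (tendsto_exp_atBot.comp ?_).const_mul 4
      have : Tendsto (fun t : ℝ => t * (-(1 / 2)) + dist o z) atTop atBot :=
        tendsto_atBot_add_const_right _ _ (tendsto_id.atTop_mul_const_of_neg (by norm_num))
      refine this.congr fun t => ?_
      ring
    rw [mul_zero] at this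
    exact ((eventually_ge_atTop _).and (this.eventually (gt_mem_nhds hε))).exists
  have hT0 : 0 ≤ T := by linarith [dist_nonneg (x := o) (y := z)]
  have hlt : ∀ᶠ t in atTop, gromovProduct o (x t) (y t) < T := by
    have h1 := ((hx z).sub (hy z)).abs
    filter_upwards [h1.eventually (lt_mem_nhds hTε), eventually_ge_atTop 0] with t ht h0
    by_contra! hle
    have := hX.abs_busemann_sub_le dist_nonneg hTR hle (le_refl (dist o z))
    rw [hox t h0, hoy t h0] at this
    linarith
  refine ⟨2 * (T + 1), fun w => ?_⟩
  refine ge_of_tendsto ((hx w).max (hy w)) ?_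
  filter_upwards [hlt, eventually_ge_atTop 0] with t ht h0
  -- By hyperbolicity one of the two products with `w` is below `T + 1`; unfolded, this is
  -- coercivity with constant `2 * (T + 1)`.
  have h2 : ¬ (T + 1 ≤ gromovProduct o (x t) w ∧ T + 1 ≤ gromovProduct o w (y t)) := by
    rintro ⟨ha, hb⟩
    have := hX.hyperbolic (by linarith) ha hb
    linarith
  rw [le_max_iff]
  by_contra! hcon
  apply h2
  simp only [gromovProduct, hox t h0, hoy t h0]
  rw [dist_comm w (y t)]
  constructor <;> linarith [hcon.1, hcon.2]

end Busemann

/-! ### The maximum of two normalised functions -/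

section NormalizedMax

open Filter

/-- The value of the normalised maximum of two functions with values `u` and `v`, the second one
shifted by `C`. -/
def normalizedMax (u v C : ℝ) : ℝ := max u (v + C) - max 0 C

theorem normalizedMax_self (u C : ℝ) : normalizedMax u u C = u := by
  have : max u (u + C) = u + max 0 C := by rw [← max_add_add_left, add_zero]
  rw [normalizedMax, this, add_sub_cancel_right]

theorem normalizedMax_neg (u v C : ℝ) : normalizedMax u v (-C) = normalizedMax v u C := by
  have h1 : max u (v + -C) = max v (u + C) - C := by
    rw [← max_sub_sub_right, max_comm]; congr 1; ring
  have h2 : max 0 (-C) = max 0 C - C := by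
    rw [← max_sub_sub_right, max_comm]; congr 1 <;> ring
  rw [normalizedMax, normalizedMax, h1, h2]; ring

theorem sub_abs_le_normalizedMax {u v m : ℝ} (h : m ≤ max u v) (C : ℝ) :
    m - |C| ≤ normalizedMax u v C := by
  have h1 := le_max_left u (v + C)
  have h2 := le_max_right u (v + C)
  rw [normalizedMax]
  rcases le_total 0 C with hC | hC
  · rw [abs_of_nonneg hC, max_eq_right hC]
    rcases le_max_iff.1 h with h | h <;> linarith
  · rw [abs_of_nonpos hC, max_eq_left hC]
    rcases le_max_iff.1 h with h | h <;> linarith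

variable {α : Type*} {l : Filter α} {u v C : α → ℝ} {u₀ v₀ C₀ : ℝ}

theorem Filter.Tendsto.normalizedMax (hu : Tendsto u l (𝓝 u₀)) (hv : Tendsto v l (𝓝 v₀))
    (hC : Tendsto C l (𝓝 C₀)) :
    Tendsto (fun a => normalizedMax (u a) (v a) (C a)) l (𝓝 (normalizedMax u₀ v₀ C₀)) :=
  (hu.max (hv.add hC)).sub (tendsto_const_nhds.max hC)

/-- Once `C` exceeds both 0 and `u - v`, the maximum selects the second function and the shift
cancels. -/
theorem tendsto_normalizedMax_atTop (hu : Tendsto u l (𝓝 u₀)) (hv : Tendsto v l (𝓝 v₀))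
    (hC : Tendsto C l atTop) :
    Tendsto (fun a => normalizedMax (u a) (v a) (C a)) l (𝓝 v₀) := by
  refine hv.congr' ?_
  filter_upwards [hC.eventually_ge_atTop 0, hC.eventually_ge_atTop (u₀ + 1 - (v₀ - 1)),
    hu.eventually (gt_mem_nhds (lt_add_one u₀)), hv.eventually (lt_mem_nhds (sub_one_lt v₀))]
    with a h0 h1 h2 h3
  rw [normalizedMax, max_eq_right (by linarith), max_eq_right h0]
  ring

theorem tendsto_normalizedMax_atBot (hu : Tendsto u l (𝓝 u₀)) (hv : Tendsto v l (𝓝 v₀))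
    (hC : Tendsto C l atBot) :
    Tendsto (fun a => normalizedMax (u a) (v a) (C a)) l (𝓝 u₀) := by
  have := tendsto_normalizedMax_atTop hv hu (tendsto_neg_atBot_atTop.comp hC)
  simpa only [Function.comp_apply, normalizedMax_neg] using this

theorem Ultrafilter.tendsto_real_trichotomy (g : Ultrafilter α) (C : α → ℝ) :
    Tendsto C g atTop ∨ Tendsto C g atBot ∨ ∃ c, Tendsto C g (𝓝 c) := by
  by_cases h1 : ∀ b, ∀ᶠ a in (g : Filter α), b ≤ C a
  · exact Or.inl (tendsto_atTop.2 h1)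
  by_cases h2 : ∀ b, ∀ᶠ a in (g : Filter α), C a ≤ b
  · exact Or.inr (Or.inl (tendsto_atBot.2 h2))
  push Not at h1 h2
  obtain ⟨b, hb⟩ := h1
  obtain ⟨b', hb'⟩ := h2
  obtain ⟨c, -, hc⟩ := (isCompact_Icc (a := b') (b := b)).ultrafilter_le_nhds (g.map C) (by
    rw [le_principal_iff]
    change ∀ᶠ a in (g : Filter α), C a ∈ Icc b' b
    filter_upwards [hb, hb'] with a h h'
    exact ⟨h'.le, h.le⟩)
  exact Or.inr (Or.inr ⟨c, hc⟩)

end NormalizedMax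

/-! ### The compactification of the product for the maximum metric -/

section Product

open Filter Metric

variable {X : Type*} [MetricSpace X]

theorem normalizedRep_maxClass (o : X) (ξ η : FnModConst X) (C : ℝ) (z w : X) :
    normalizedRep (o, o) (maxClass o ξ η C) (z, w) =
      normalizedMax (normalizedRep o ξ z) (normalizedRep o η w) C := by
  change max (normalizedRep o ξ z) (normalizedRep o η w + C) -
    max (normalizedRep o ξ o) (normalizedRep o η o + C) = _
  rw [normalizedRep_self, normalizedRep_self, zero_add, normalizedMax]

/-- This puts points of `X × X` in the same family of normalised maxima as the elements of the ideal
domain, so one limit analysis serves both. -/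
theorem normalizedRep_horoEmb_prod (o x y z w : X) :
    normalizedRep (o, o) (horoEmb (x, y)) (z, w) =
      normalizedMax (normalizedRep o (horoEmb x) z) (normalizedRep o (horoEmb y) w)
        (dist y o - dist x o) := by
  rw [normalizedRep_horoEmb, normalizedRep_horoEmb, normalizedRep_horoEmb, Prod.dist_eq,
    Prod.dist_eq, normalizedMax, sub_add_sub_cancel, max_sub_sub_right,
    ← sub_self (dist x o), max_sub_sub_right]
  ring

/-- The possible limits of normalised maxima along an ultrafilter. -/
theorem Ultrafilter.normalizedMax_limits (o : X) {α : Type*} (g : Ultrafilter α)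
    {ξ η : α → FnModConst X} {C : α → ℝ} {f : α → FnModConst (X × X)} {ξ₀ η₀ : FnModConst X}
    {f₀ : FnModConst (X × X)} (hξ : Tendsto ξ g (𝓝 ξ₀)) (hη : Tendsto η g (𝓝 η₀))
    (hf : Tendsto f g (𝓝 f₀))
    (h : ∀ a z w, normalizedRep (o, o) (f a) (z, w) =
      normalizedMax (normalizedRep o (ξ a) z) (normalizedRep o (η a) w) (C a)) :
    (Tendsto C g atTop ∧ ∀ z w, normalizedRep (o, o) f₀ (z, w) = normalizedRep o η₀ w) ∨
    (Tendsto C g atBot ∧ ∀ z w, normalizedRep (o, o) f₀ (z, w) = normalizedRep o ξ₀ z) ∨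
    ∃ c, Tendsto C g (𝓝 c) ∧ f₀ = maxClass o ξ₀ η₀ c := by
  have h1 : ∀ z, Tendsto (fun a => normalizedRep o (ξ a) z) g (𝓝 (normalizedRep o ξ₀ z)) :=
    fun z => ((continuous_normalizedRep_apply o z).tendsto ξ₀).comp hξ
  have h2 : ∀ z, Tendsto (fun a => normalizedRep o (η a) z) g (𝓝 (normalizedRep o η₀ z)) :=
    fun z => ((continuous_normalizedRep_apply o z).tendsto η₀).comp hη
  have h3 : ∀ z w, Tendsto (fun a => normalizedMax (normalizedRep o (ξ a) z)
      (normalizedRep o (η a) w) (C a)) g (𝓝 (normalizedRep (o, o) f₀ (z, w))) := fun z w => by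
    simp only [← h]
    exact ((continuous_normalizedRep_apply (o, o) (z, w)).tendsto f₀).comp hf
  rcases g.tendsto_real_trichotomy C with hC | hC | ⟨c, hC⟩
  · exact Or.inl ⟨hC, fun z w =>
      tendsto_nhds_unique (h3 z w) (tendsto_normalizedMax_atTop (h1 z) (h2 w) hC)⟩
  · exact Or.inr (Or.inl ⟨hC, fun z w =>
      tendsto_nhds_unique (h3 z w) (tendsto_normalizedMax_atBot (h1 z) (h2 w) hC)⟩)
  · refine Or.inr (Or.inr ⟨c, hC, FnModConst.ext_normalizedRep (o, o) ?_⟩)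
    rintro ⟨z, w⟩
    rw [normalizedRep_maxClass]
    exact tendsto_nhds_unique (h3 z w) ((h1 z).normalizedMax (h2 w) hC)

/-- The restriction of the function `f` to the diagonal has a minimum at `p`. -/
def IsDiagMin (o : X) (f : FnModConst (X × X)) (p : X) : Prop :=
  ∀ z, normalizedRep (o, o) f (p, p) ≤ normalizedRep (o, o) f (z, z)

theorem isDiagMin_fnClass {o : X} {h : C(X × X, ℝ)} {p : X} :
    IsDiagMin o (fnClass h) p ↔ ∀ z, h (p, p) ≤ h (z, z) := by
  simp only [IsDiagMin, normalizedRep_fnClass, sub_le_sub_iff_right]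

/-- A boundary function can be lowered by 1 starting from any point. -/
theorem not_isDiagMin [ProperSpace X] (hX : IsCATMinusOne X) {o : X} {f : FnModConst (X × X)}
    {ξ : FnModConst X} (hξ : ξ ∈ horoBoundary X)
    (h : ∀ z, normalizedRep (o, o) f (z, z) = normalizedRep o ξ z) (p : X) :
    ¬ IsDiagMin o f p := by
  intro hp
  obtain ⟨q, -, hq⟩ := ((mem_horoBoundary_iff hX.1 o).1 hξ).2 p 1 zero_le_one
  have := hp q
  rw [h, h] at this
  linarith

/-- Either an ultrafilter of points converges, or it leaves all balls and its limits in the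
compactification are boundary points. -/
theorem Ultrafilter.tendsto_or_mem_horoBoundary [ProperSpace X] (hX : IsCATMinusOne X) (o : X)
    {α : Type*} (g : Ultrafilter α) (x : α → X) {ξ : FnModConst X}
    (hξ : Tendsto (fun a => horoEmb (x a)) g (𝓝 ξ)) :
    (∃ x₀, Tendsto x g (𝓝 x₀)) ∨
      (Tendsto (fun a => dist (x a) o) g atTop ∧ ξ ∈ horoBoundary X) := by
  by_cases hb : ∃ R, ∀ᶠ a in (g : Filter α), dist (x a) o ≤ R
  · obtain ⟨R, hR⟩ := hb
    obtain ⟨x₀, -, hx₀⟩ := (isCompact_closedBall o R).ultrafilter_le_nhds (g.map x) (by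
      rw [le_principal_iff]
      exact hR)
    exact Or.inl ⟨x₀, hx₀⟩
  · push Not at hb
    have hb' : ∀ R, ∀ᶠ a in (g : Filter α), R ≤ dist (x a) o := fun R =>
      (hb R).mono fun a h => h.le
    refine Or.inr ⟨tendsto_atTop.2 hb', (mem_horoBoundary_iff hX.1 o).2 ⟨?_, fun p r hr => ?_⟩⟩
    · exact isClosed_horoClosure.mem_of_tendsto hξ
        (Eventually.of_forall fun a => horoEmb_mem_horoClosure _)
    · refine (isClosed_setOf_descends o p r).mem_of_tendsto hξ ?_
      filter_upwards [hb' (r + dist o p)] with a ha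
      refine descends_horoEmb hX.1 o hr ?_
      have := dist_triangle p (x a) o
      have := dist_triangle (x a) p o
      rw [dist_comm (x a) p, dist_comm p o] at this
      linarith

/-- A function in the compactification of the product whose restriction to the diagonal has a
minimum is a distance function or belongs to the ideal domain. -/
theorem mem_union_idealDomain_of_isDiagMin [ProperSpace X] (hX : IsCATMinusOne X) {o : X}
    {f : FnModConst (X × X)} (hf : f ∈ horoClosure (X × X)) {p : X} (hp : IsDiagMin o f p) :
    f ∈ range (horoEmb (M := X × X)) ∪ idealDomain o := by
  obtain ⟨g', hg', hgf⟩ := mem_closure_iff_ultrafilter.1 hf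
  obtain ⟨g, rfl⟩ : ∃ g : Ultrafilter (X × X), g.map horoEmb = g' :=
    ⟨_, Ultrafilter.ofComapInfPrincipal_eq_of_map (s := univ) (by rwa [image_univ])⟩
  have hgf' : Tendsto horoEmb (g : Filter (X × X)) (𝓝 f) := hgf
  have hlim : ∀ u : X × X → X, ∃ ξ, Tendsto (fun a => horoEmb (u a)) g (𝓝 ξ) := fun u => by
    obtain ⟨ξ, -, hξ⟩ := isCompact_horoClosure.ultrafilter_le_nhds
      (g.map fun a => horoEmb (u a)) (by
        rw [le_principal_iff, Ultrafilter.coe_map, mem_map]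
        exact univ_mem' fun a => horoEmb_mem_horoClosure _)
    exact ⟨ξ, hξ⟩
  obtain ⟨ξ, hξ⟩ := hlim Prod.fst
  obtain ⟨η, hη⟩ := hlim Prod.snd
  have hx := g.tendsto_or_mem_horoBoundary hX o Prod.fst hξ
  have hy := g.tendsto_or_mem_horoBoundary hX o Prod.snd hη
  have hd : ∀ {u : X × X → X} {x₀ : X}, Tendsto u g (𝓝 x₀) →
      Tendsto (fun a => dist (u a) o) g (𝓝 (dist x₀ o)) := fun h => h.dist tendsto_const_nhds
  rcases g.normalizedMax_limits o hξ hη hgf'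
    (fun a z w => normalizedRep_horoEmb_prod o a.1 a.2 z w) with
    ⟨hC, h⟩ | ⟨hC, h⟩ | ⟨c, hC, h⟩
  · rcases hy with ⟨y₀, hy⟩ | ⟨-, hηb⟩
    · refine absurd (hC.eventually_gt_atTop (dist y₀ o + 1)) ?_
      have : ∀ᶠ a in (g : Filter (X × X)), ¬ (dist y₀ o + 1 < dist a.2 o - dist a.1 o) := by
        filter_upwards [(hd hy).eventually (gt_mem_nhds (lt_add_one _))] with a ha
        linarith [dist_nonneg (x := a.1) (y := o)]
      exact fun h => (h.and this).exists.elim fun a ha => ha.2 ha.1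
    · exact absurd hp (not_isDiagMin hX hηb (fun z => h z z) p)
  · rcases hx with ⟨x₀, hx⟩ | ⟨-, hξb⟩
    · refine absurd (hC.eventually_lt_atBot (-(dist x₀ o + 1))) ?_
      have : ∀ᶠ a in (g : Filter (X × X)), ¬ (dist a.2 o - dist a.1 o < -(dist x₀ o + 1)) := by
        filter_upwards [(hd hx).eventually (gt_mem_nhds (lt_add_one _))] with a ha
        linarith [dist_nonneg (x := a.2) (y := o)]
      exact fun h => (h.and this).exists.elim fun a ha => ha.2 ha.1
    · exact absurd hp (not_isDiagMin hX hξb (fun z => h z z) p)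
  -- With a convergent shift, the coordinates either both converge or both escape. In the latter
  -- case `ξ = η` is excluded, as the diagonal restriction would be a Busemann function.
  · rcases hx with ⟨x₀, hx⟩ | ⟨hx, hξb⟩ <;> rcases hy with ⟨y₀, hy⟩ | ⟨hy, hηb⟩
    · left
      have h1 : Tendsto (fun a : X × X => a) g (𝓝 (x₀, y₀)) := hx.prodMk_nhds hy
      exact ⟨(x₀, y₀), tendsto_nhds_unique ((continuous_horoEmb.tendsto _).comp h1) hgf'⟩
    · have : Tendsto (fun a : X × X => dist a.2 o) g (𝓝 (c + dist x₀ o)) :=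
        (hC.add (hd hx)).congr fun a => by ring
      exact absurd hy (not_tendsto_atTop_of_tendsto_nhds this)
    · have : Tendsto (fun a : X × X => dist a.1 o) g (𝓝 (dist y₀ o - c)) :=
        ((hd hy).sub hC).congr fun a => by ring
      exact absurd hx (not_tendsto_atTop_of_tendsto_nhds this)
    · right
      have hne : ξ ≠ η := by
        rintro rfl
        refine not_isDiagMin hX hξb (fun z => ?_) p hp
        rw [h, normalizedRep_maxClass, normalizedMax_self]
      exact ⟨(⟨(⟨ξ, hξb⟩, ⟨η, hηb⟩), fun h => hne (congrArg Subtype.val h)⟩, c), h.symm⟩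

theorem maxClass_mem_horoClosure [ProperSpace X] (hX : IsCATMinusOne X) (o : X)
    {ξ η : FnModConst X} (hξ : ξ ∈ horoBoundary X) (hη : η ∈ horoBoundary X) (C : ℝ) :
    maxClass o ξ η C ∈ horoClosure (X × X) := by
  obtain ⟨x, hox, -, hx⟩ := hX.exists_ray o hξ
  obtain ⟨y, hoy, -, hy⟩ := hX.exists_ray o hη
  have hC : Tendsto (fun t : ℝ => t + C) atTop atTop := tendsto_atTop_add_const_right _ _ tendsto_id
  -- The offset between the two rays makes the shift of the approximating distance functions equal
  -- to `C` for large `t`.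
  refine isClosed_horoClosure.mem_of_tendsto
    (f := fun t => horoEmb (x t, y (t + C))) (b := atTop) ?_
    (Eventually.of_forall fun _ => horoEmb_mem_horoClosure _)
  refine tendsto_of_tendsto_normalizedRep (o, o) (fun _ => horoEmb_mem_horoClosure _) ?_
  rintro ⟨z, w⟩
  rw [normalizedRep_maxClass]
  refine ((hx z).normalizedMax ((hy w).comp hC) (tendsto_const_nhds (x := C))).congr' ?_
  filter_upwards [eventually_ge_atTop 0, hC.eventually_ge_atTop 0] with t h0 h1
  rw [normalizedRep_horoEmb_prod, normalizedRep_horoEmb, normalizedRep_horoEmb,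
    dist_comm (x t) o, dist_comm (y (t + C)) o, hox t h0, hoy _ h1]
  congr 1
  ring

/-- Along two rays followed simultaneously the function equals `-t`, hence is unbounded below,
unlike a distance function. -/
theorem idealDomain_subset_horoBoundary [ProperSpace X] (hX : IsCATMinusOne X) (o : X) :
    idealDomain o ⊆ horoBoundary (X × X) := by
  rintro _ ⟨⟨⟨⟨⟨ξ, hξ⟩, ⟨η, hη⟩⟩, hne⟩, C⟩, rfl⟩
  refine ⟨maxClass_mem_horoClosure hX o hξ hη C, ?_⟩
  rintro ⟨⟨a, b⟩, h⟩
  change horoEmb (a, b) = maxClass o ξ η C at h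
  obtain ⟨x, -, hx, -⟩ := hX.exists_ray o hξ
  obtain ⟨y, -, hy, -⟩ := hX.exists_ray o hη
  have h0 : 0 ≤ dist (a, b) (o, o) + 1 := by positivity
  have h1 := normalizedRep_maxClass o ξ η C (x (dist (a, b) (o, o) + 1))
    (y (dist (a, b) (o, o) + 1))
  rw [← h, hx _ h0, hy _ h0, normalizedMax_self, normalizedRep_horoEmb] at h1
  linarith [dist_nonneg (x := (a, b))
    (y := (x (dist (a, b) (o, o) + 1), y (dist (a, b) (o, o) + 1)))]

theorem mem_horoClosure_of_mem_union [ProperSpace X] (hX : IsCATMinusOne X) {o : X}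
    {f : FnModConst (X × X)} (hf : f ∈ range (horoEmb (M := X × X)) ∪ idealDomain o) :
    f ∈ horoClosure (X × X) :=
  hf.elim (fun h => subset_closure h) fun h => (idealDomain_subset_horoBoundary hX o h).1

/-- Distance functions and functions in the ideal domain are coercive on the diagonal. -/
theorem exists_dist_sub_le_normalizedRep [ProperSpace X] (hX : IsCATMinusOne X) {o : X}
    {f : FnModConst (X × X)} (hf : f ∈ range (horoEmb (M := X × X)) ∪ idealDomain o) :
    ∃ c, ∀ z, dist o z - c ≤ normalizedRep (o, o) f (z, z) := by
  rcases hf with ⟨⟨x, y⟩, rfl⟩ | ⟨⟨⟨⟨⟨ξ, hξ⟩, ⟨η, hη⟩⟩, hne⟩, C⟩, rfl⟩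
  · refine ⟨dist o x + dist (x, y) (o, o), fun z => ?_⟩
    rw [normalizedRep_horoEmb, Prod.dist_eq (x := (x, y)) (y := (z, z))]
    have h1 := le_max_left (dist x z) (dist y z)
    have h2 := dist_triangle o x z
    simp only at h1 ⊢
    linarith
  · obtain ⟨c, hc⟩ := hX.exists_le_max_normalizedRep o hξ hη
      (fun h => hne (Subtype.ext h))
    refine ⟨c + |C|, fun z => ?_⟩
    change _ ≤ normalizedRep (o, o) (maxClass o ξ η C) (z, z)
    rw [normalizedRep_maxClass]
    linarith [sub_abs_le_normalizedMax (hc z) C]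

/-- The functions of the compactification are quasi-convex on the diagonal. -/
theorem normalizedRep_diag_le_max (hX : IsCATMinusOne X) {o p q : X} {f : FnModConst (X × X)}
    (hf : f ∈ horoClosure (X × X)) {c : ℝ → X} (hc : IsGeodesicSegment c p q) {s : ℝ}
    (hs : s ∈ Icc 0 (dist p q)) :
    normalizedRep (o, o) f (c s, c s) ≤
      max (normalizedRep (o, o) f (p, p)) (normalizedRep (o, o) f (q, q)) := by
  have hcl : IsClosed {f : FnModConst (X × X) | normalizedRep (o, o) f (c s, c s) ≤
      max (normalizedRep (o, o) f (p, p)) (normalizedRep (o, o) f (q, q))} :=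
    isClosed_le (continuous_normalizedRep_apply _ _)
      ((continuous_normalizedRep_apply _ _).max (continuous_normalizedRep_apply _ _))
  refine closure_minimal ?_ hcl hf
  rintro _ ⟨⟨x, y⟩, rfl⟩
  simp only [mem_ofPred_eq, normalizedRep_horoEmb, max_sub_sub_right, sub_le_sub_iff_right,
    Prod.dist_eq]
  refine max_le ((hX.dist_le_max hc x hs).trans ?_) ((hX.dist_le_max hc y hs).trans ?_)
  · exact max_le_max (le_max_left _ _) (le_max_left _ _)
  · exact max_le_max (le_max_right _ _) (le_max_right _ _)

/-- The classes of functions whose restriction to the diagonal is greater on the sphere of radius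
`R` around `o` than at `o`. -/
def diagBarrier (o : X) (R : ℝ) : Set (FnModConst (X × X)) :=
  {f | ∀ z ∈ sphere o R, 0 < normalizedRep (o, o) f (z, z)}

theorem isOpen_diagBarrier [ProperSpace X] (o : X) (R : ℝ) : IsOpen (diagBarrier o R) := by
  have hK : IsCompact ((fun z : X => (z, z)) '' sphere o R) :=
    (isCompact_sphere o R).image (continuous_id.prodMk continuous_id)
  have := (ContinuousMap.isOpen_setOfPred_mapsTo hK (isOpen_Ioi (a := (0 : ℝ)))).preimage
    (continuous_normalizedRep (o, o))
  convert this using 1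
  ext f
  simp [diagBarrier, MapsTo]

theorem exists_mem_diagBarrier [ProperSpace X] (hX : IsCATMinusOne X) {o : X}
    {f : FnModConst (X × X)} (hf : f ∈ range (horoEmb (M := X × X)) ∪ idealDomain o) :
    ∃ R, 0 ≤ R ∧ f ∈ diagBarrier o R := by
  obtain ⟨c, hc⟩ := exists_dist_sub_le_normalizedRep hX hf
  have h0 := hc o
  rw [normalizedRep_self, dist_self] at h0
  refine ⟨c + 1, by linarith, fun z hz => ?_⟩
  rw [mem_sphere, dist_comm] at hz
  linarith [hc z]

/-- The geodesic from `o` to `z` crosses the sphere at a positive value. As the value at `o` is 0,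
quasi-convexity forces the value at `z` to be positive. -/
theorem pos_of_mem_diagBarrier (hX : IsCATMinusOne X) {o : X} {R : ℝ} (hR : 0 ≤ R)
    {f : FnModConst (X × X)} (hf : f ∈ horoClosure (X × X)) (hfR : f ∈ diagBarrier o R) {z : X}
    (hz : R ≤ dist o z) : 0 < normalizedRep (o, o) f (z, z) := by
  obtain ⟨c, hc⟩ := hX.1 o z
  have h1 := hfR (c R) (by rw [mem_sphere, dist_comm, hc.dist_source ⟨hR, hz⟩])
  have h2 := h1.trans_le (normalizedRep_diag_le_max hX (o := o) hf hc ⟨hR, hz⟩)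
  rw [normalizedRep_self] at h2
  exact (lt_max_iff.1 h2).resolve_left (lt_irrefl 0)

theorem IsDiagMin.dist_lt (hX : IsCATMinusOne X) {o p : X} {R : ℝ} (hR : 0 ≤ R)
    {f : FnModConst (X × X)} (hp : IsDiagMin o f p) (hf : f ∈ horoClosure (X × X))
    (hfR : f ∈ diagBarrier o R) : dist o p < R := by
  by_contra! h
  have h1 := pos_of_mem_diagBarrier hX hR hf hfR h
  have h2 := hp o
  rw [normalizedRep_self] at h2
  linarith

theorem exists_isDiagMin [ProperSpace X] (hX : IsCATMinusOne X) {o : X} {R : ℝ} (hR : 0 ≤ R)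
    {f : FnModConst (X × X)} (hf : f ∈ horoClosure (X × X)) (hfR : f ∈ diagBarrier o R) :
    ∃ p, IsDiagMin o f p := by
  have hcont : Continuous fun z : X => normalizedRep (o, o) f (z, z) :=
    (normalizedRep (o, o) f).continuous.comp (continuous_id.prodMk continuous_id)
  obtain ⟨p, -, hmin⟩ := (isCompact_closedBall o R).exists_isMinOn
    ⟨o, mem_closedBall_self hR⟩ hcont.continuousOn
  refine ⟨p, fun z => ?_⟩
  rcases le_total (dist o z) R with h | h
  · exact hmin (by rwa [mem_closedBall, dist_comm] : z ∈ closedBall o R)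
  · have h1 := hmin (mem_closedBall_self hR : o ∈ closedBall o R)
    have h2 := pos_of_mem_diagBarrier hX hR hf hfR h
    simp only [mem_ofPred_eq] at h1
    rw [normalizedRep_self] at h1
    exact h1.trans h2.le

theorem isOpen_preimage_idealDomain [ProperSpace X] (hX : IsCATMinusOne X) (o : X) :
    IsOpen ((↑) ⁻¹' idealDomain o : Set (horoBoundary (X × X))) := by
  rw [isOpen_iff_forall_mem_open]
  rintro ⟨f, hfb⟩ (hf : f ∈ idealDomain o)
  obtain ⟨R, hR, hfR⟩ := exists_mem_diagBarrier hX (Or.inr hf)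
  refine ⟨Subtype.val ⁻¹' diagBarrier o R, ?_,
    (isOpen_diagBarrier o R).preimage continuous_subtype_val, hfR⟩
  rintro ⟨f', hf'b⟩ (hf'R : f' ∈ diagBarrier o R)
  obtain ⟨p, hp⟩ := exists_isDiagMin hX hR hf'b.1 hf'R
  exact (mem_union_idealDomain_of_isDiagMin hX hf'b.1 hp).resolve_left hf'b.2

end Product

/-! ### The parametrization of the ideal domain -/

section Parametrization

open Filter Metric

variable {X : Type*} [MetricSpace X]

theorem continuous_idealDomainParam [ProperSpace X] (o : X) : Continuous (idealDomainParam o) := by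
  have h : ∀ u : {q : horoBoundary X × horoBoundary X // q.1 ≠ q.2} × ℝ → FnModConst X,
      Continuous u → ∀ v : X × X → X, Continuous v →
      Continuous fun x : ({q : horoBoundary X × horoBoundary X // q.1 ≠ q.2} × ℝ) × (X × X) =>
        normalizedRep o (u x.1) (v x.2) := fun u hu v hv =>
    (continuous_normalizedRep_uncurry o).comp
      ((hu.comp continuous_fst).prodMk (hv.comp continuous_snd))
  refine continuous_fnClass.comp (ContinuousMap.continuous_of_continuous_uncurry _ ?_)
  exact (h (fun q => q.1.1.1.1) (by fun_prop) _ continuous_fst).max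
    ((h (fun q => q.1.1.2.1) (by fun_prop) _ continuous_snd).add
      (continuous_snd.comp continuous_fst))

/-- The second function can be recovered from a normalised maximum, up to the constant, by taking
the infimum over the first variable. -/
theorem snd_add_le_of_maxClass_eq [ProperSpace X] (hX : IsCATMinusOne X) {o : X}
    {ξ η ξ' η' : FnModConst X} {C C' : ℝ} (hξ : ξ ∈ horoBoundary X)
    (h : maxClass o ξ η C = maxClass o ξ' η' C') (w : X) :
    normalizedRep o η' w + C' - max 0 C' ≤ normalizedRep o η w + C - max 0 C := by
  obtain ⟨x, -, hx, -⟩ := hX.exists_ray o hξ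
  -- Following the ray to `ξ` for this long pushes the first function below `normalizedRep o η w +
  -- C`, so the maximum is the second term.
  have ht : 0 ≤ |normalizedRep o η w + C| := abs_nonneg _
  have h1 := congrArg (fun f =>
    normalizedRep (o, o) f (x |normalizedRep o η w + C|, w)) h
  simp only [normalizedRep_maxClass, normalizedMax, hx _ ht] at h1
  rw [max_eq_right (neg_abs_le _)] at h1
  rw [h1]
  exact sub_le_sub_right (le_max_right _ _) _

theorem fst_le_of_maxClass_eq [ProperSpace X] (hX : IsCATMinusOne X) {o : X}
    {ξ η ξ' η' : FnModConst X} {C C' : ℝ} (hη : η ∈ horoBoundary X)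
    (h : maxClass o ξ η C = maxClass o ξ' η' C') (z : X) :
    normalizedRep o ξ' z - max 0 C' ≤ normalizedRep o ξ z - max 0 C := by
  obtain ⟨y, -, hy, -⟩ := hX.exists_ray o hη
  have ht : 0 ≤ |normalizedRep o ξ z - C| := abs_nonneg _
  have h1 := congrArg (fun f =>
    normalizedRep (o, o) f (z, y |normalizedRep o ξ z - C|)) h
  simp only [normalizedRep_maxClass, normalizedMax, hy _ ht] at h1
  rw [max_eq_left (by linarith [neg_abs_le (normalizedRep o ξ z - C)])] at h1
  rw [h1]
  exact sub_le_sub_right (le_max_left _ _) _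

theorem maxClass_inj [ProperSpace X] (hX : IsCATMinusOne X) {o : X}
    {ξ η ξ' η' : FnModConst X} {C C' : ℝ} (hξ : ξ ∈ horoBoundary X) (hη : η ∈ horoBoundary X)
    (hξ' : ξ' ∈ horoBoundary X) (hη' : η' ∈ horoBoundary X)
    (h : maxClass o ξ η C = maxClass o ξ' η' C') : ξ = ξ' ∧ η = η' ∧ C = C' := by
  have h1 : ∀ z, normalizedRep o ξ z - max 0 C = normalizedRep o ξ' z - max 0 C' := fun z =>
    le_antisymm (fst_le_of_maxClass_eq hX hη' h.symm z) (fst_le_of_maxClass_eq hX hη h z)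
  have h2 : ∀ z, normalizedRep o η z + C - max 0 C = normalizedRep o η' z + C' - max 0 C' :=
    fun z => le_antisymm (snd_add_le_of_maxClass_eq hX hξ' h.symm z)
      (snd_add_le_of_maxClass_eq hX hξ h z)
  have h1o := h1 o
  have h2o := h2 o
  rw [normalizedRep_self, normalizedRep_self] at h1o h2o
  exact ⟨FnModConst.ext_normalizedRep o fun z => by linarith [h1 z],
    FnModConst.ext_normalizedRep o fun z => by linarith [h2 z], by linarith⟩

theorem idealDomainParam_injective [ProperSpace X] (hX : IsCATMinusOne X) (o : X) :
    Function.Injective (idealDomainParam o) := by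
  rintro ⟨⟨⟨⟨ξ, hξ⟩, ⟨η, hη⟩⟩, hne⟩, C⟩ ⟨⟨⟨⟨ξ', hξ'⟩, ⟨η', hη'⟩⟩, hne'⟩, C'⟩ h
  obtain ⟨rfl, rfl, rfl⟩ := maxClass_inj hX hξ hη hξ' hη' h
  rfl

/-- Along an ultrafilter whose images converge, the boundary points have limits by compactness, and
the shift stays bounded because the limit function has a diagonal minimum. `maxClass_inj` then
identifies the limits; it does not require the limiting boundary points to be distinct. -/
theorem isEmbedding_idealDomainParam [ProperSpace X] (hX : IsCATMinusOne X) (o : X) :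
    IsEmbedding (idealDomainParam o) := by
  refine ⟨isInducing_iff_nhds.2 fun q₀ => le_antisymm
    ((continuous_idealDomainParam o).tendsto q₀).le_comap ?_, idealDomainParam_injective hX o⟩
  rw [le_iff_ultrafilter]
  intro g hg
  have hf : Tendsto (idealDomainParam o) g (𝓝 (idealDomainParam o q₀)) := tendsto_iff_comap.2 hg
  have hlim : ∀ u : {q : horoBoundary X × horoBoundary X // q.1 ≠ q.2} × ℝ → horoBoundary X,
      ∃ ξ ∈ horoBoundary X, Tendsto (fun q => (u q).1) g (𝓝 ξ) := fun u => by
    obtain ⟨ξ, -, hξ⟩ := isCompact_horoClosure.ultrafilter_le_nhds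
      (g.map fun a => (u a).1) (by
        rw [le_principal_iff, Ultrafilter.coe_map, mem_map]
        exact univ_mem' fun a => (u a).2.1)
    have hξ' : Tendsto (fun q => (u q).1) g (𝓝 ξ) := hξ
    exact ⟨ξ, (isClosed_horoBoundary hX.1).mem_of_tendsto hξ'
      (Eventually.of_forall fun a => (u a).2), hξ'⟩
  obtain ⟨ξ, hξb, hξ⟩ := hlim fun q => q.1.1.1
  obtain ⟨η, hηb, hη⟩ := hlim fun q => q.1.1.2
  have hmem : idealDomainParam o q₀ ∈ range (horoEmb (M := X × X)) ∪ idealDomain o :=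
    Or.inr ⟨q₀, rfl⟩
  obtain ⟨R, hR, hfR⟩ := exists_mem_diagBarrier hX hmem
  obtain ⟨p, hp⟩ := exists_isDiagMin hX hR (mem_horoClosure_of_mem_union hX hmem) hfR
  rcases g.normalizedMax_limits o hξ hη hf
    (fun q z w => normalizedRep_maxClass o q.1.1.1.1 q.1.1.2.1 q.2 z w) with
    ⟨-, h⟩ | ⟨-, h⟩ | ⟨c, hc, h⟩
  · exact absurd hp (not_isDiagMin hX hηb (fun z => h z z) p)
  · exact absurd hp (not_isDiagMin hX hξb (fun z => h z z) p)
  · obtain ⟨⟨⟨⟨ξ₀, hξ₀⟩, ⟨η₀, hη₀⟩⟩, hne⟩, C₀⟩ := q₀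
    obtain ⟨rfl, rfl, rfl⟩ := maxClass_inj hX hξ₀ hη₀ hξb hηb h
    have h1 : Tendsto (fun q : {q : horoBoundary X × horoBoundary X // q.1 ≠ q.2} × ℝ => q.1.1.1)
        g (𝓝 ⟨ξ₀, hξ₀⟩) := tendsto_subtype_rng.2 hξ
    have h2 : Tendsto (fun q : {q : horoBoundary X × horoBoundary X // q.1 ≠ q.2} × ℝ => q.1.1.2)
        g (𝓝 ⟨η₀, hη₀⟩) := tendsto_subtype_rng.2 hη
    have h3 : Tendsto (fun q : {q : horoBoundary X × horoBoundary X // q.1 ≠ q.2} × ℝ => q.1)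
        g (𝓝 ⟨(⟨ξ₀, hξ₀⟩, ⟨η₀, hη₀⟩), hne⟩) :=
      tendsto_subtype_rng.2 (h1.prodMk_nhds h2)
    exact h3.prodMk_nhds hc

end Parametrization

/-! ### The group action -/

section Action

open Filter Metric

variable {X : Type*} [MetricSpace X] {Γ : Type*} [Group Γ] [MulAction Γ X] [IsIsometricSMul Γ X]

theorem smul_fnClass (γ : Γ) (f : C(X, ℝ)) : γ • fnClass f = fnClass (translateFn γ f) := rfl

theorem continuous_smul_fnModConst (γ : Γ) : Continuous fun ξ : FnModConst X => γ • ξ := by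
  refine continuous_quot_lift _ ?_
  exact continuous_fnClass.comp (ContinuousMap.continuous_precomp _)

theorem smul_mem_horoClosure (γ : Γ) {ξ : FnModConst X} (hξ : ξ ∈ horoClosure X) :
    γ • ξ ∈ horoClosure X := by
  refine map_mem_closure (continuous_smul_fnModConst γ) hξ ?_
  rintro _ ⟨p, rfl⟩
  exact ⟨γ • p, (smul_horoEmb γ p).symm⟩

theorem IsDiagMin.smul {o p : X} {f : FnModConst (X × X)} (hp : IsDiagMin o f p) (γ : Γ) :
    IsDiagMin o (γ • f) (γ • p) := by
  obtain ⟨h, rfl⟩ := fnClass_surjective f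
  rw [isDiagMin_fnClass] at hp
  rw [smul_fnClass, isDiagMin_fnClass]
  intro z
  change h (γ⁻¹ • (γ • p, γ • p)) ≤ h (γ⁻¹ • (z, z))
  rw [Prod.smul_mk, Prod.smul_mk, inv_smul_smul]
  exact hp _

theorem exists_isDiagMin_of_mem_union [ProperSpace X] (hX : IsCATMinusOne X) {o : X}
    {f : FnModConst (X × X)} (hf : f ∈ range (horoEmb (M := X × X)) ∪ idealDomain o) :
    ∃ p, IsDiagMin o f p := by
  obtain ⟨R, hR, hfR⟩ := exists_mem_diagBarrier hX hf
  exact exists_isDiagMin hX hR (mem_horoClosure_of_mem_union hX hf) hfR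

theorem exists_dist_le_of_isCompact [ProperSpace X] (hX : IsCATMinusOne X) {o : X}
    {K : Set (FnModConst (X × X))} (hK : IsCompact K)
    (hKS : K ⊆ range (horoEmb (M := X × X)) ∪ idealDomain o) :
    ∃ R, ∀ f ∈ K, ∀ p, IsDiagMin o f p → dist o p ≤ R := by
  refine hK.induction_on (p := fun s => ∃ R, ∀ f ∈ s, ∀ p, f ∈ K → IsDiagMin o f p → dist o p ≤ R)
    ⟨0, fun f hf => absurd hf (notMem_empty f)⟩ ?_ ?_ ?_ |>.imp fun R h f hf p => h f hf p hf
  · rintro s t hst ⟨R, hR⟩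
    exact ⟨R, fun f hf => hR f (hst hf)⟩
  · rintro s t ⟨R, hR⟩ ⟨R', hR'⟩
    refine ⟨max R R', fun f hf p hfK hp => ?_⟩
    rcases hf with hf | hf
    · exact (hR f hf p hfK hp).trans (le_max_left _ _)
    · exact (hR' f hf p hfK hp).trans (le_max_right _ _)
  · intro f hf
    obtain ⟨R, hR, hfR⟩ := exists_mem_diagBarrier hX (hKS hf)
    refine ⟨diagBarrier o R, mem_nhdsWithin_of_mem_nhds
      ((isOpen_diagBarrier o R).mem_nhds hfR), R, fun f' hf' p hfK hp => ?_⟩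
    exact (hp.dist_lt hX hR (mem_horoClosure_of_mem_union hX (hKS hfK)) hf').le

/-- If `f'` and `γ • f'` both lie in `K`, then `γ` carries a minimum point of `f'` within one fixed
ball to another point of that ball. -/
theorem properlyDiscontinuousOn_union_idealDomain [ProperSpace X] (hX : IsCATMinusOne X)
    (hpd : ProperlyDiscontinuousOn Γ (univ : Set X)) (o : X) :
    ProperlyDiscontinuousOn Γ (range (horoEmb (M := X × X)) ∪ idealDomain o) := by
  intro K hKS hK
  obtain ⟨R, hR⟩ := exists_dist_le_of_isCompact hX hK hKS
  refine (hpd (closedBall o R) (subset_univ _) (isCompact_closedBall o R)).subset ?_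
  rintro γ ⟨f, hf, f', hf', rfl⟩
  obtain ⟨p, hp⟩ := exists_isDiagMin_of_mem_union hX (hKS hf')
  refine ⟨γ • p, ?_, smul_mem_smul_set ?_⟩
  · rw [mem_closedBall, dist_comm]; exact hR _ hf _ (hp.smul γ)
  · rw [mem_closedBall, dist_comm]; exact hR _ hf' _ hp

/-- The compact set consists of the classes with a minimum point in a compact `K` whose translates
cover `X`. Any minimum point can be moved into `K`; uniqueness of minima is not needed. -/
theorem cocompactOn_union_idealDomain [ProperSpace X] (hX : IsCATMinusOne X)
    (hcc : CocompactOn Γ (univ : Set X)) (o : X) :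
    CocompactOn Γ (range (horoEmb (M := X × X)) ∪ idealDomain o) := by
  obtain ⟨K, -, hK, hcov⟩ := hcc
  have hclosed : IsClosed {f : FnModConst (X × X) | ∃ p ∈ K, IsDiagMin o f p} := by
    refine hK.isClosed_setOf_exists (P := fun f p => IsDiagMin o f p) ?_
    have : {x : FnModConst (X × X) × X | IsDiagMin o x.1 x.2} = ⋂ z : X,
        {x | normalizedRep (o, o) x.1 (x.2, x.2) ≤ normalizedRep (o, o) x.1 (z, z)} := by
      ext x
      simp [IsDiagMin]
    rw [this]
    refine isClosed_iInter fun z => isClosed_le ?_ ?_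
    · exact (continuous_normalizedRep_uncurry (o, o)).comp
        (continuous_fst.prodMk (continuous_snd.prodMk continuous_snd))
    · exact (continuous_normalizedRep_apply (o, o) (z, z)).comp continuous_fst
  refine ⟨horoClosure (X × X) ∩ {f | ∃ p ∈ K, IsDiagMin o f p}, ?_,
    isCompact_horoClosure.inter_right hclosed, ?_⟩
  · rintro f ⟨hf, p, -, hp⟩
    exact mem_union_idealDomain_of_isDiagMin hX hf hp
  · refine Subset.antisymm (fun f hf => ?_) (iUnion_subset fun γ => ?_)
    · obtain ⟨p, hp⟩ := exists_isDiagMin_of_mem_union hX hf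
      have hpu : p ∈ ⋃ γ : Γ, γ • K := hcov ▸ mem_univ p
      obtain ⟨γ, k, hk, rfl⟩ := mem_iUnion.1 hpu
      refine mem_iUnion.2 ⟨γ, mem_smul_set_iff_inv_smul_mem.2
        ⟨smul_mem_horoClosure γ⁻¹ (mem_horoClosure_of_mem_union hX hf), k, hk, ?_⟩⟩
      have := hp.smul γ⁻¹
      rwa [inv_smul_smul] at this
    · rintro _ ⟨f, ⟨hf, p, -, hp⟩, rfl⟩
      exact mem_union_idealDomain_of_isDiagMin hX (smul_mem_horoClosure γ hf) (hp.smul γ)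

end Action

end

theorem theorem1 {X : Type*} [MetricSpace X] [ProperSpace X] [NoncompactSpace X]
    (hX : IsCATMinusOne X)
    {Γ : Type*} [Group Γ] [MulAction Γ X] [IsIsometricSMul Γ X]
    (hpd : ProperlyDiscontinuousOn Γ (Set.univ : Set X))
    (hcc : CocompactOn Γ (Set.univ : Set X))
    (o : X) :
    -- the ideal domain lies in the boundary for the maximum metric, and is open there
    idealDomain o ⊆ horoBoundary (X × X) ∧
    IsOpen ((↑) ⁻¹' idealDomain o : Set (horoBoundary (X × X))) ∧
    -- it corresponds homeomorphically to `((∂X × ∂X) ∖ D) × ℝ`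
    IsEmbedding (idealDomainParam o) ∧
    -- the diagonal action on its union with `X × X`
    ProperlyDiscontinuousOn Γ (Set.range (horoEmb (M := X × X)) ∪ idealDomain o) ∧
    CocompactOn Γ (Set.range (horoEmb (M := X × X)) ∪ idealDomain o) := by
  exact ⟨idealDomain_subset_horoBoundary hX o, isOpen_preimage_idealDomain hX o,
    isEmbedding_idealDomainParam hX o, properlyDiscontinuousOn_union_idealDomain hX hpd o,
    cocompactOn_union_idealDomain hX hcc o⟩
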